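/- For real $z$, $a>-1$ and $b$ let $W(z,a,b)=\sum_{n\ge 0}\frac{z^n}{n!\,\Gamma(an+b)}$ be the Wright function (with $1/\Gamma=0$ at the poles of $\Gamma$), and let $M_\nu(z)=W(-z,-\nu,1-\nu)$ be the Mainardi function. For $0<\alpha<1$ let $D^\alpha f(t)=\frac{1}{\Gamma(1-\alpha)}\int_0^t (t-\tau)^{-\alpha}f'(\tau)\,d\tau$ be the Caputo derivative (in time, with base point $0$). Let $0<\alpha<1$, $\lambda,k,h,m,D>0$ and $C<D$. Consider the fractional one-phase Stefan problem with a convective boundary condition $$\begin{cases} D^\alpha u(x,t)=\lambda^2 u_{xx}(x,t), & 0<x<s(t),\ t>0,\\ m\,u_x(0,t)=\dfrac{h}{t^{\alpha/2}}\,(u(0,t)-D), & t>0,\\ u(s(t),t)=C, & t>0,\\ D^\alpha s(t)=-k\,u_x(s(t),t), & t>0,\\ s(0)=0.\end{cases}\tag{St3}$$ A solution is a pair of functions $u$ on $\{x\ge 0,\ t>0\}$ and $s$ on $[0,\infty)$ with $s(t)>0$ for $t>0$, that satisfies (St3), where the derivatives in (St3) exist (in a Caputo derivative at time $t$ the function is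 differentiable on $(0,t)$ and the integrand is integrable), and such that: $u_{xx}$ and $D^\alpha u$ are continuous on $\{0<x<s(t),\,t>0\}$; $u$ and $u_x$ (one-sided at the end points) are continuous on $\{0\le x\le s(t),\,t>0\}$; as $(x,t)\to(0,0)$ within $0<x<s(t)$, $t>0$, one has $-\infty<\liminf u\le\limsup u<+\infty$, and $\liminf u\ge 0$ if $C\ge 0$; $s$ is continuous on $[0,\infty)$ and continuously differentiable on $(0,\infty)$, and $\dot s(\tau)(t-\tau)^{-\alpha}\in L^1(0,t)$ for all $t>0$. Define, for $\eta>0$, $$K(\eta)=\eta\left[1-W\left(-\eta,-\tfrac{\alpha}{2},1\right)+\frac{m}{h\lambda\Gamma(1-\alpha/2)}\right]\frac{1}{M_{\alpha/2}(\eta)}.$$ Then $K$ is continuous and strictly increasing on $(0,\infty)$, $K(0^+)=0$ and $K(+\infty)=+\infty$. There is exactly one $\tilde\eta>0$ with $$K(\tilde\eta)=\frac{k}{\lambda^2}\,\frac{\Gamma(1-\frac{\alpha}{2})}{\Gamma(1+\frac{\alpha}{2})}\,(D-C),$$ and the pair $$u_3(x,t)=D-\frac{(D-C)\left[1-W\left(-\frac{x}{\lambda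 t^{\alpha/2}},-\frac{\alpha}{2},1\right)+\frac{m}{h\lambda\Gamma(1-\alpha/2)}\right]}{1-W\left(-\tilde\eta,-\frac{\alpha}{2},1\right)+\frac{m}{h\lambda\Gamma(1-\alpha/2)}},\qquad s_3(t)=\lambda\tilde\eta\,t^{\alpha/2},$$ is a solution of (St3). It is the only solution $\{u,s\}$ of (St3) in which $u$ has the form $u(x,t)=a+b\,W\left(-\frac{x}{\lambda t^{\alpha/2}},-\frac{\alpha}{2},1\right)$ with constants $a,b$. -/

import Mathlib

open Filter Topology Set

namespace FractionalStefan

noncomputable section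

/-- The Wright function `W(z, a, b) = ∑ zⁿ / (n! Γ(a n + b))`, for real arguments; the series converges
absolutely for every `z` when `a > -1`. At the poles of `Γ` Mathlib has `Gamma = 0`, so that the
corresponding term is `0`, which is the usual convention `1 / Γ = 0` there. -/
def wright (z a b : ℝ) : ℝ :=
  ∑' n : ℕ, z ^ n / ((n.factorial : ℝ) * Real.Gamma (a * n + b))

/-- The Mainardi function `M_ν(z) = W(-z, -ν, 1 - ν)`. -/
def mainardi (ν z : ℝ) : ℝ := wright (-z) (-ν) (1 - ν)

/-- The Caputo derivative of order `0 < α < 1` with base point `0`: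
`D^α f(t) = 1 / Γ(1 - α) ∫₀ᵗ (t - τ)^(-α) f'(τ) dτ`. -/
def caputoDeriv (α : ℝ) (f : ℝ → ℝ) (t : ℝ) : ℝ :=
  1 / Real.Gamma (1 - α) * ∫ τ in (0 : ℝ)..t, (t - τ) ^ (-α) * deriv f τ

/-- The Caputo derivative of order `0 < α < 1` of `f` exists at `t`: the function `f` is
differentiable on `(0, t)` and the integrand of the defining integral is Lebesgue integrable. -/
def CaputoDifferentiableAt (α : ℝ) (f : ℝ → ℝ) (t : ℝ) : Prop :=
  (∀ τ ∈ Ioo 0 t, DifferentiableAt ℝ f τ) ∧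
    IntervalIntegrable (fun τ => (t - τ) ^ (-α) * deriv f τ) MeasureTheory.volume 0 t

/-- The region `0 < x < s(t)`, `t > 0`, as a set of pairs `(x, t)`. -/
def openRegion (s : ℝ → ℝ) : Set (ℝ × ℝ) := {p | 0 < p.2 ∧ 0 < p.1 ∧ p.1 < s p.2}

/-- The region `0 ≤ x ≤ s(t)`, `t > 0`, as a set of pairs `(x, t)`. -/
def closedRegion (s : ℝ → ℝ) : Set (ℝ × ℝ) := {p | 0 < p.2 ∧ 0 ≤ p.1 ∧ p.1 ≤ s p.2}

/-- The space derivative `u_x(x, t)` for `0 ≤ x ≤ s(t)`, one-sided at the two end points. -/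
def spaceDeriv (u : ℝ → ℝ → ℝ) (s : ℝ → ℝ) (x t : ℝ) : ℝ :=
  derivWithin (fun y => u y t) (Icc 0 (s t)) x

/-- The second space derivative `u_xx(x, t)` at interior points. -/
def spaceDeriv₂ (u : ℝ → ℝ → ℝ) (x t : ℝ) : ℝ :=
  deriv (fun z => deriv (fun y => u y t) z) x

/-- `{u, s}` is a (classical, global in time) solution of the one-phase fractional Stefan problem with
a convective condition at `x = 0`. The function `u = u(x, t)` is given on the quarter plane, since
the Caputo derivative in time at a point of the region has base point `0`. -/
structure IsSolution (α lam k h m C D : ℝ) (u : ℝ → ℝ → ℝ) (s : ℝ → ℝ) : Prop where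
  s_pos : ∀ t, 0 < t → 0 < s t
  /- the equations of the problem -/
  diffusion : ∀ x t, 0 < t → 0 < x → x < s t →
    caputoDeriv α (fun τ => u x τ) t = lam ^ 2 * spaceDeriv₂ u x t
  convective : ∀ t, 0 < t → m * spaceDeriv u s 0 t = h / t ^ (α / 2) * (u 0 t - D)
  front_temp : ∀ t, 0 < t → u (s t) t = C
  stefan : ∀ t, 0 < t → caputoDeriv α s t = -k * spaceDeriv u s (s t) t
  s_zero : s 0 = 0
  /- the derivatives occurring in the equations exist and are continuous -/
  caputo_u : ∀ x t, 0 < t → 0 < x → x < s t → CaputoDifferentiableAt α (fun τ => u x τ) t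
  caputo_u_cont : ContinuousOn (fun p : ℝ × ℝ => caputoDeriv α (fun τ => u p.1 τ) p.2) (openRegion s)
  diff_xx : ∀ x t, 0 < t → 0 < x → x < s t →
    DifferentiableAt ℝ (fun z => deriv (fun y => u y t) z) x
  u_xx_cont : ContinuousOn (fun p : ℝ × ℝ => spaceDeriv₂ u p.1 p.2) (openRegion s)
  u_cont : ContinuousOn (fun p : ℝ × ℝ => u p.1 p.2) (closedRegion s)
  diff_x : ∀ x t, 0 < t → 0 ≤ x → x ≤ s t →
    DifferentiableWithinAt ℝ (fun y => u y t) (Icc 0 (s t)) x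
  u_x_cont : ContinuousOn (fun p : ℝ × ℝ => spaceDeriv u s p.1 p.2) (closedRegion s)
  /- behaviour of `u` at the corner `x, t → 0⁺` of the region -/
  corner_bot : ⊥ < liminf (fun p : ℝ × ℝ => (u p.1 p.2 : EReal)) (𝓝[openRegion s] (0, 0))
  corner_nonneg : 0 ≤ C →
    0 ≤ liminf (fun p : ℝ × ℝ => (u p.1 p.2 : EReal)) (𝓝[openRegion s] (0, 0))
  corner_le : liminf (fun p : ℝ × ℝ => (u p.1 p.2 : EReal)) (𝓝[openRegion s] (0, 0)) ≤
    limsup (fun p : ℝ × ℝ => (u p.1 p.2 : EReal)) (𝓝[openRegion s] (0, 0))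
  corner_top : limsup (fun p : ℝ × ℝ => (u p.1 p.2 : EReal)) (𝓝[openRegion s] (0, 0)) < ⊤
  /- regularity of the free boundary -/
  s_cont : ContinuousOn s (Ici 0)
  s_diff : ∀ t, 0 < t → DifferentiableAt ℝ s t
  s_deriv_cont : ContinuousOn (deriv s) (Ioi 0)
  caputo_s : ∀ t, 0 < t → CaputoDifferentiableAt α s t

/-- `K(η) = η [1 - W(-η, -α/2, 1) + m / (h λ Γ(1 - α/2))] / M_{α/2}(η)`. -/
def K (α lam h m η : ℝ) : ℝ :=
  η * (1 - wright (-η) (-(α / 2)) 1 + m / (h * lam * Real.Gamma (1 - α / 2))) *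
    (1 / mainardi (α / 2) η)

/-- The temperature `u₃(x, t)` with parameter `η`. -/
def u₃ (α lam h m C D η : ℝ) (x t : ℝ) : ℝ :=
  D - (D - C) * (1 - wright (-(x / (lam * t ^ (α / 2)))) (-(α / 2)) 1 +
        m / (h * lam * Real.Gamma (1 - α / 2))) /
      (1 - wright (-η) (-(α / 2)) 1 + m / (h * lam * Real.Gamma (1 - α / 2)))

/-- The free boundary `s₃(t) = λ η t^{α/2}` with parameter `η`. -/
def s₃ (α lam η : ℝ) (t : ℝ) : ℝ := lam * η * t ^ (α / 2)

end

end FractionalStefan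

open FractionalStefan

open MeasureTheory

/-! ### The Wright series: convergence, derivative, parameter recurrence. -/

namespace FractionalStefan

/-! Write ν = α/2, E(y) = W(-y, -ν, 1) and M = M_ν. Then E' = -M, and each y-derivative lowers the
last parameter by ν, so E'' = W(-y, -ν, 1 - α). The profile a + b E(x / (λ t^ν)) solves the
diffusion equation because its Caputo derivative produces this same function. That is the case γ = 1
- α of `fractional_integral_wright`, which is proved by Mellin transforms: both sides have transform
Γ(γ) Γ(p) / Γ(γ + νp), and Mellin inversion makes them equal.

The sign facts needed for K are M > 0 and M nonincreasing on [0, ∞). Positivity rests on an extremum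
principle. By the case γ = 1 - ν, the Caputo derivative of order ν of τ ↦ E(y τ^(-ν)) at time 1 is
M(y) = -E'(y). If E had an interior minimum below its limit L at infinity, or an interior maximum
above L on a half-line, M would vanish there, while the extremum principle gives it a strict sign.
Hence E is monotone and, by analyticity, stays strictly above L; the principle then gives Γ(1 - ν)
M(y) ≥ E(y) - L > 0. The case γ = 1 - 2ν writes -M' as an integral of a nonnegative function.

So K is a product of increasing factors, and the positive convective constant keeps it above a
linear function. For a similarity profile, the convective and front conditions fix a and b in terms
of η, and the Stefan condition becomes the equation for K(η). Conversely, injectivity of E forces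
the front of any similarity solution to be λ η t^ν. -/

theorem rpow_le_one_add_sqrt {ν r : ℝ} (hν0 : 0 ≤ ν) (hν : ν ≤ 1 / 2) (hr : 0 ≤ r) :
    r ^ ν ≤ 1 + √r := by
  rcases le_total r 1 with h | h
  · linarith [Real.rpow_le_one hr h hν0, Real.sqrt_nonneg r]
  · have := Real.rpow_le_rpow_of_exponent_le h hν
    rw [Real.sqrt_eq_rpow]
    linarith

/-- Young's inequality x√r ≤ (x² + r)/2. The coefficient 1/2 of r lets half of e^(-r) absorb the
growth of e^(x r^ν). -/
theorem mul_rpow_le {ν r x : ℝ} (hν0 : 0 ≤ ν) (hν : ν ≤ 1 / 2) (hr : 0 ≤ r) (hx : 0 ≤ x) :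
    x * r ^ ν ≤ x + x ^ 2 / 2 + r / 2 := by
  have h1 := mul_le_mul_of_nonneg_left (rpow_le_one_add_sqrt hν0 hν hr) hx
  nlinarith [sq_nonneg (x - √r), Real.sq_sqrt hr]

/-- The kernel `r^(-b) e^(-r)`, times `e^(x r^ν)`, is integrable on `(0, ∞)`. -/
theorem integrableOn_kernel_mul_exp {ν b x : ℝ} (hν0 : 0 ≤ ν) (hν : ν ≤ 1 / 2) (hb : b < 1)
    (hx : 0 ≤ x) :
    IntegrableOn (fun r : ℝ => r ^ (-b) * Real.exp (-r) * Real.exp (x * r ^ ν)) (Ioi 0) := by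
  have h := (integrableOn_rpow_mul_exp_neg_mul_rpow (s := -b) (p := 1) (b := 1 / 2)
    (by linarith) (by norm_num) (by norm_num)).const_mul (Real.exp (x + x ^ 2 / 2))
  refine Integrable.mono' h ?_ ?_
  · exact (by fun_prop : Measurable _).aestronglyMeasurable
  · filter_upwards [ae_restrict_mem measurableSet_Ioi] with r hr
    have hr' : (0 : ℝ) < r := hr
    rw [Real.norm_of_nonneg (by positivity), mul_assoc, ← Real.exp_add, mul_left_comm,
      ← Real.exp_add]
    refine mul_le_mul_of_nonneg_left (Real.exp_le_exp.2 ?_) (by positivity)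
    have := mul_rpow_le hν0 hν hr'.le hx
    rw [Real.rpow_one]
    linarith

theorem integral_rpow_mul_exp_neg {b : ℝ} (hb : b < 1) :
    ∫ r in Ioi (0 : ℝ), r ^ (-b) * Real.exp (-r) = Real.Gamma (1 - b) := by
  rw [Real.Gamma_eq_integral (by linarith)]
  refine setIntegral_congr_fun measurableSet_Ioi fun r _ => ?_
  rw [mul_comm, show 1 - b - 1 = -b by ring]

/-- The reflection formula for the reciprocal Gamma function, with the convention `1 / Γ = 0` at the
poles. -/
theorem one_div_Gamma_eq {s : ℝ} (hs : s < 1) :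
    1 / Real.Gamma s = Real.Gamma (1 - s) * Real.sin (Real.pi * s) / Real.pi := by
  have h := Real.Gamma_mul_Gamma_one_sub s
  have h1 : Real.Gamma (1 - s) ≠ 0 := (Real.Gamma_pos_of_pos (by linarith)).ne'
  by_cases hsin : Real.sin (Real.pi * s) = 0
  -- At a zero of the sine the reflection formula reads Γ(s) Γ(1 - s) = 0, by division by zero. As
  -- Γ(1 - s) ≠ 0, this yields Γ(s) = 0, and both sides of the claim vanish.
  · rw [hsin, div_zero, mul_eq_zero] at h
    rw [h.resolve_right h1, hsin]
    simp
  · have hg : Real.Gamma s ≠ 0 := by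
      intro h0
      rw [h0, zero_mul, eq_comm, div_eq_zero_iff] at h
      exact h.elim Real.pi_ne_zero hsin
    rw [eq_div_iff hsin] at h
    rw [div_eq_div_iff hg Real.pi_ne_zero]
    linarith

/-- The series is the termwise integral of e^(x r^ν) against r^(-b) e^(-r). All terms are
nonnegative, so the series serves as its own majorant in dominated convergence. -/
theorem summable_Gamma_series {ν b x : ℝ} (hν0 : 0 ≤ ν) (hν : ν ≤ 1 / 2) (hb : b < 1)
    (hx : 0 ≤ x) :
    Summable (fun n : ℕ => x ^ n / n.factorial * Real.Gamma (1 - b + ν * n)) := by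
  let F : ℕ → ℝ → ℝ := fun n r => r ^ (-b) * Real.exp (-r) * ((x * r ^ ν) ^ n / n.factorial)
  have hlim : ∀ r : ℝ, HasSum (fun n => F n r)
      (r ^ (-b) * Real.exp (-r) * Real.exp (x * r ^ ν)) := by
    intro r
    have h := NormedSpace.expSeries_div_hasSum_exp (x * r ^ ν)
    rw [← Real.exp_eq_exp_ℝ] at h
    exact h.mul_left _
  have key : HasSum (fun n => ∫ r in Ioi (0 : ℝ), F n r)
      (∫ r in Ioi (0 : ℝ), r ^ (-b) * Real.exp (-r) * Real.exp (x * r ^ ν)) := by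
    refine hasSum_integral_of_dominated_convergence F
      (fun n => (by fun_prop : Measurable (F n)).aestronglyMeasurable) (fun n => ?_)
      (ae_of_all _ fun r => (hlim r).summable) ?_ (ae_of_all _ hlim)
    · filter_upwards [ae_restrict_mem measurableSet_Ioi] with r hr
      have hr' : (0 : ℝ) < r := hr
      exact (Real.norm_of_nonneg (by positivity)).le
    · exact (integrableOn_kernel_mul_exp hν0 hν hb hx).congr
        (ae_of_all _ fun r => ((hlim r).tsum_eq).symm)
  refine key.summable.congr fun n => ?_
  have : (1 : ℝ) - b + ν * n = 1 - (b - ν * n) := by ring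
  rw [this, ← integral_rpow_mul_exp_neg (by nlinarith [mul_nonneg hν0 (n.cast_nonneg (α := ℝ))]),
    ← integral_const_mul]
  refine setIntegral_congr_fun measurableSet_Ioi fun r hr => ?_
  have hr' : (0 : ℝ) < r := hr
  simp only [F]
  rw [mul_pow, ← Real.rpow_mul_natCast hr'.le, show -(b - ν * n) = -b + ν * n by ring,
    Real.rpow_add hr']
  ring

/-- Reflection turns 1/Γ(b - νn) into Γ(1 - b + νn) times a sine over π, so the preceding series
dominates. -/
theorem summable_wright {ν b : ℝ} (hν0 : 0 ≤ ν) (hν : ν ≤ 1 / 2) (hb : b < 1) (z : ℝ) :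
    Summable (fun n : ℕ => |z ^ n / ((n.factorial : ℝ) * Real.Gamma (-ν * n + b))|) := by
  refine Summable.of_nonneg_of_le (fun n => abs_nonneg _) (fun n => ?_)
    ((summable_Gamma_series hν0 hν hb (abs_nonneg z)).mul_right Real.pi⁻¹)
  have h1 : -ν * n + b < 1 := by nlinarith [mul_nonneg hν0 n.cast_nonneg]
  have h2 := one_div_Gamma_eq h1
  have h3 : 0 < Real.Gamma (1 - b + ν * n) :=
    Real.Gamma_pos_of_pos (by nlinarith [mul_nonneg hν0 n.cast_nonneg])
  have h4 : z ^ n / ((n.factorial : ℝ) * Real.Gamma (-ν * n + b)) =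
      z ^ n / n.factorial * (1 / Real.Gamma (-ν * n + b)) := by
    rw [div_mul_div_comm, mul_one]
  rw [h4, h2, abs_mul, abs_div, abs_pow, abs_div, abs_mul, show 1 - (-ν * n + b) = 1 - b + ν * n by ring,
    abs_of_pos h3, abs_of_pos Real.pi_pos, Nat.abs_cast, div_eq_mul_inv _ Real.pi, ← mul_assoc]
  gcongr
  exact mul_le_of_le_one_right h3.le (Real.abs_sin_le_one _)

/-- Differentiation of the Wright function with respect to its argument. -/
theorem hasDerivAt_wright {ν b : ℝ} (hν0 : 0 ≤ ν) (hν : ν ≤ 1 / 2) (hb : b - ν < 1) (z : ℝ) :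
    HasDerivAt (fun z => wright z (-ν) b) (wright z (-ν) (b - ν)) z := by
  set R := |z| + 1
  -- Since -ν(n+1) + b = -νn + (b - ν), the differentiated series, shifted by one, is the Wright
  -- series with parameter b - ν. Its absolute convergence at R controls the whole ball.
  have hu : Summable fun n : ℕ => |(n * R ^ (n - 1)) / ((n.factorial : ℝ) * Real.Gamma (-ν * n + b))| := by
    rw [← summable_nat_add_iff 1]
    refine (summable_wright hν0 hν hb R).congr fun n => ?_
    rw [Nat.factorial_succ, Nat.add_sub_cancel]
    push_cast
    rw [mul_assoc, mul_div_mul_left _ _ (by positivity), show -ν * (n + 1 : ℝ) + b = -ν * n + (b - ν) by ring]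
  have h := hasDerivAt_tsum_of_isPreconnected (t := Metric.ball 0 R) (y₀ := 0) (y := z)
    (g := fun (n : ℕ) z => z ^ n / ((n.factorial : ℝ) * Real.Gamma (-ν * n + b)))
    (g' := fun (n : ℕ) z => (n * z ^ (n - 1)) / ((n.factorial : ℝ) * Real.Gamma (-ν * n + b)))
    hu Metric.isOpen_ball (convex_ball _ _).isPreconnected
    (fun n y _ => (hasDerivAt_pow n y).div_const _)
    (fun n y hy => by
      have hy' : |y| ≤ R := by simpa using (Metric.mem_ball.1 hy).le
      rw [Real.norm_eq_abs, abs_div, abs_div, abs_mul, abs_mul (n : ℝ) (R ^ (n - 1)), abs_pow,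
        abs_of_nonneg (by positivity : 0 ≤ R ^ (n - 1))]
      gcongr)
    (Metric.mem_ball_self (by positivity))
    (by
      refine summable_of_ne_finset_zero (s := {0}) fun n hn => ?_
      simp at hn
      simp [hn])
    (by simp [R])
  convert! h using 1
  have key : ∀ n : ℕ, z ^ n / ((n.factorial : ℝ) * Real.Gamma (-ν * n + (b - ν))) =
      ((n + 1 : ℕ) * z ^ (n + 1 - 1)) /
        (((n + 1).factorial : ℝ) * Real.Gamma (-ν * (n + 1 : ℕ) + b)) := by
    intro n
    rw [Nat.factorial_succ, Nat.add_sub_cancel]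
    push_cast
    rw [mul_assoc, mul_div_mul_left _ _ (by positivity),
      show -ν * (n + 1 : ℝ) + b = -ν * n + (b - ν) by ring]
  rw [tsum_eq_zero_add' (((summable_wright hν0 hν hb z).of_abs).congr key), wright, tsum_congr key]
  simp

theorem wright_zero_left (a b : ℝ) : wright 0 a b = 1 / Real.Gamma b := by
  rw [wright, tsum_eq_single 0]
  · simp
  · intro n hn
    simp [hn]

/-- The n = 0 term vanishes because Γ(0) = 0 by convention. In the others, Γ(s + 1) = s Γ(s) at s =
-ν(n+1) cancels the factor n + 1 of the factorial. -/
theorem wright_zero_right {ν : ℝ} (hν0 : 0 < ν) (hν : ν ≤ 1 / 2) (z : ℝ) :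
    wright z (-ν) 0 = -ν * z * wright z (-ν) (1 - ν) := by
  have key : ∀ n : ℕ, z ^ (n + 1) / (((n + 1).factorial : ℝ) * Real.Gamma (-ν * (n + 1 : ℕ) + 0)) =
      -ν * z * (z ^ n / ((n.factorial : ℝ) * Real.Gamma (-ν * n + (1 - ν)))) := by
    intro n
    have h0 : -ν * ((n : ℝ) + 1) ≠ 0 := by
      have : (0 : ℝ) < ν * (n + 1) := by positivity
      linarith
    have h1 := Real.Gamma_add_one h0
    rw [show -ν * (n : ℝ) + (1 - ν) = -ν * ((n : ℝ) + 1) + 1 by ring, h1, Nat.factorial_succ]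
    push_cast
    rw [add_zero]
    have : (n.factorial : ℝ) ≠ 0 := by positivity
    have : (n : ℝ) + 1 ≠ 0 := by positivity
    rw [pow_succ]
    field_simp
  rw [wright, tsum_eq_zero_add', tsum_congr key, tsum_mul_left, wright]
  · simp
  · refine (((summable_wright hν0.le hν (b := 1 - ν) (by linarith) z).of_abs).mul_left
      (-ν * z)).congr fun n => (key n).symm

end FractionalStefan

/-! ### Integral representation of the Wright function and the complex Gamma integral. -/

namespace FractionalStefan

/-- Imaginary part of the exponential series of e^(ib) exp(-u e^(-iθ)). -/
theorem hasSum_exp_mul_sin (b θ u : ℝ) :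
    HasSum (fun n : ℕ => (-u) ^ n / n.factorial * Real.sin (b - n * θ))
      (Real.exp (-(u * Real.cos θ)) * Real.sin (b + u * Real.sin θ)) := by
  have h := (NormedSpace.expSeries_div_hasSum_exp
    (-(u : ℂ) * Complex.exp (-(θ : ℂ) * Complex.I))).mul_left (Complex.exp ((b : ℂ) * Complex.I))
  rw [← Complex.exp_eq_exp_ℂ, ← Complex.exp_add] at h
  have h2 := Complex.hasSum_im h
  convert! h2 using 1
  · funext n
    rw [mul_pow, ← Complex.exp_nat_mul, mul_div_assoc', mul_left_comm, ← Complex.exp_add]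
    have : (b : ℂ) * Complex.I + n * (-(θ : ℂ) * Complex.I) = ((b - n * θ : ℝ) : ℂ) * Complex.I := by
      push_cast; ring
    rw [this, ← Complex.ofReal_neg, ← Complex.ofReal_pow, mul_div_right_comm, ← Complex.ofReal_natCast,
      ← Complex.ofReal_div, Complex.im_ofReal_mul, Complex.exp_ofReal_mul_I_im]
  · have : (b : ℂ) * Complex.I + -(u : ℂ) * Complex.exp (-(θ : ℂ) * Complex.I) =
        ((-(u * Real.cos θ) : ℝ) : ℂ) + ((b + u * Real.sin θ : ℝ) : ℂ) * Complex.I := by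
      rw [← Complex.ofReal_neg θ, Complex.exp_mul_I, ← Complex.ofReal_cos, ← Complex.ofReal_sin,
        Real.cos_neg, Real.sin_neg]
      push_cast
      ring
    rw [this, Complex.exp_add, ← Complex.ofReal_exp, Complex.im_ofReal_mul,
      Complex.exp_ofReal_mul_I_im]

/-- The real integral representation of the Wright function. -/
theorem wright_eq_integral {ν b : ℝ} (hν0 : 0 ≤ ν) (hν : ν ≤ 1 / 2) (hb : b < 1) (y : ℝ) :
    wright (-y) (-ν) b = Real.pi⁻¹ * ∫ r in Ioi (0 : ℝ), r ^ (-b) * Real.exp (-r) *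
      (Real.exp (-(y * r ^ ν * Real.cos (Real.pi * ν))) *
        Real.sin (Real.pi * b + y * r ^ ν * Real.sin (Real.pi * ν))) := by
  -- `F n` integrates to π times the n-th Wright term, by reflection and the integral for Γ(1 - b +
  -- νn). `B n` is its majorant, with the sine dropped and y replaced by |y|.
  let F : ℕ → ℝ → ℝ := fun n r => r ^ (-b) * Real.exp (-r) *
    ((-(y * r ^ ν)) ^ n / n.factorial * Real.sin (Real.pi * b - n * (Real.pi * ν)))
  let B : ℕ → ℝ → ℝ := fun n r => r ^ (-b) * Real.exp (-r) * ((|y| * r ^ ν) ^ n / n.factorial)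
  have hlim : ∀ r : ℝ, HasSum (fun n => F n r) (r ^ (-b) * Real.exp (-r) *
      (Real.exp (-(y * r ^ ν * Real.cos (Real.pi * ν))) *
        Real.sin (Real.pi * b + y * r ^ ν * Real.sin (Real.pi * ν)))) := fun r =>
    (hasSum_exp_mul_sin _ _ _).mul_left _
  have hB : ∀ r : ℝ, HasSum (fun n => B n r)
      (r ^ (-b) * Real.exp (-r) * Real.exp (|y| * r ^ ν)) := by
    intro r
    have h := NormedSpace.expSeries_div_hasSum_exp (|y| * r ^ ν)
    rw [← Real.exp_eq_exp_ℝ] at h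
    exact h.mul_left _
  have key : HasSum (fun n => ∫ r in Ioi (0 : ℝ), F n r)
      (∫ r in Ioi (0 : ℝ), r ^ (-b) * Real.exp (-r) *
      (Real.exp (-(y * r ^ ν * Real.cos (Real.pi * ν))) *
        Real.sin (Real.pi * b + y * r ^ ν * Real.sin (Real.pi * ν)))) := by
    refine hasSum_integral_of_dominated_convergence B
      (fun n => (by fun_prop : Measurable (F n)).aestronglyMeasurable) (fun n => ?_)
      (ae_of_all _ fun r => (hB r).summable) ?_ (ae_of_all _ hlim)
    · filter_upwards [ae_restrict_mem measurableSet_Ioi] with r hr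
      have hr' : (0 : ℝ) < r := hr
      have h1 : 0 < r ^ ν := by positivity
      simp only [F, B]
      rw [Real.norm_eq_abs, abs_mul, abs_mul (_ / _), abs_div, abs_pow, abs_neg, abs_mul y,
        abs_of_pos h1, Nat.abs_cast, abs_of_nonneg (by positivity : 0 ≤ r ^ (-b) * Real.exp (-r))]
      exact mul_le_mul_of_nonneg_left
        (mul_le_of_le_one_right (by positivity) (Real.abs_sin_le_one _)) (by positivity)
    · exact (integrableOn_kernel_mul_exp hν0 hν hb (abs_nonneg y)).congr
        (ae_of_all _ fun r => ((hB r).tsum_eq).symm)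
  rw [← key.tsum_eq, ← tsum_mul_left, wright]
  refine tsum_congr fun n => ?_
  have h1 : b - ν * n < 1 := by nlinarith [mul_nonneg hν0 (n.cast_nonneg (α := ℝ))]
  have h2 : ∫ r in Ioi (0 : ℝ), F n r = Real.Gamma (1 - (b - ν * n)) *
      ((-y) ^ n / n.factorial * Real.sin (Real.pi * b - n * (Real.pi * ν))) := by
    rw [← integral_rpow_mul_exp_neg h1, ← integral_mul_const]
    refine setIntegral_congr_fun measurableSet_Ioi fun r hr => ?_
    have hr' : (0 : ℝ) < r := hr
    simp only [F]
    rw [← neg_mul, mul_pow, ← Real.rpow_mul_natCast hr'.le, show -(b - ν * n) = -b + ν * n by ring,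
      Real.rpow_add hr']
    ring
  have h3 := one_div_Gamma_eq h1
  rw [h2, show -ν * n + b = b - ν * n by ring, ← mul_one (((-y) ^ n)), ← div_mul_div_comm, h3,
    show Real.pi * b - n * (Real.pi * ν) = Real.pi * (b - ν * n) by ring]
  ring

theorem cos_pi_mul_pos {ν : ℝ} (hν0 : 0 ≤ ν) (hν : ν < 1 / 2) : 0 < Real.cos (Real.pi * ν) := by
  refine Real.cos_pos_of_mem_Ioo ⟨?_, ?_⟩ <;> nlinarith [Real.pi_pos]

/-- For ν < 1/2 the cosine in the integral representation is positive, and e^(-u) ≤ 1/u suffices.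
The decay 1/y bounds τ⁻¹ W(-y τ^(-ν), -ν, 0) by a multiple of τ^(ν-1), which is integrable at 0. -/
theorem exists_abs_wright_zero_le {ν : ℝ} (hν0 : 0 ≤ ν) (hν : ν < 1 / 2) :
    ∃ C : ℝ, 0 ≤ C ∧ ∀ y : ℝ, 0 < y → |wright (-y) (-ν) 0| ≤ C / y := by
  have hc := cos_pi_mul_pos hν0 hν
  refine ⟨Real.pi⁻¹ * ((Real.cos (Real.pi * ν))⁻¹ * Real.Gamma (1 - ν)), ?_, fun y hy => ?_⟩
  · have : 0 < Real.Gamma (1 - ν) := Real.Gamma_pos_of_pos (by linarith)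
    positivity
  have hint : IntegrableOn (fun r : ℝ => r ^ (-ν) * Real.exp (-r)) (Ioi 0) := by
    simpa using integrableOn_kernel_mul_exp hν0 hν.le (b := ν) (x := 0) (by linarith) le_rfl
  rw [wright_eq_integral hν0 hν.le (by norm_num), abs_mul, abs_of_pos (inv_pos.2 Real.pi_pos),
    mul_div_assoc, ← integral_rpow_mul_exp_neg (by linarith : ν < 1), ← integral_const_mul,
    ← integral_div]
  refine mul_le_mul_of_nonneg_left ?_ (by positivity)
  rw [← Real.norm_eq_abs]
  refine norm_integral_le_of_norm_le ((hint.const_mul _).div_const y) ?_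
  filter_upwards [ae_restrict_mem measurableSet_Ioi] with r hr
  have hr' : (0 : ℝ) < r := hr
  rw [neg_zero, Real.rpow_zero, one_mul, Real.norm_eq_abs, abs_mul, abs_mul, Real.abs_exp, Real.abs_exp]
  have hu : 0 < y * r ^ ν * Real.cos (Real.pi * ν) := by positivity
  have h1 : Real.exp (-(y * r ^ ν * Real.cos (Real.pi * ν))) ≤
      (y * r ^ ν * Real.cos (Real.pi * ν))⁻¹ := by
    rw [Real.exp_neg]
    gcongr
    linarith [Real.add_one_le_exp (y * r ^ ν * Real.cos (Real.pi * ν))]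
  calc Real.exp (-r) * (Real.exp (-(y * r ^ ν * Real.cos (Real.pi * ν))) * |_|)
      ≤ Real.exp (-r) * ((y * r ^ ν * Real.cos (Real.pi * ν))⁻¹ * 1) := by
        gcongr
        exact Real.abs_sin_le_one _
    _ = _ := by
        rw [Real.rpow_neg hr'.le]
        field_simp

/-- The Gamma integral with a complex rate of decay. -/
theorem integral_cpow_mul_exp_neg_mul {p z : ℂ} (hp : 0 < p.re) (hz : 0 < z.re) :
    ∫ t in Ioi (0 : ℝ), (t : ℂ) ^ (p - 1) * Complex.exp (-(z * t)) =
      z ^ (-p) * Complex.Gamma p := by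
  set U : Set ℂ := {z | 0 < z.re}
  have hU : IsOpen U := isOpen_lt continuous_const Complex.continuous_re
  have hUc : IsPreconnected U := (convex_halfSpace_re_gt 0).isPreconnected
  have hnorm : ∀ (q : ℂ) (w : ℂ) (t : ℝ), 0 < t →
      ‖(t : ℂ) ^ q * Complex.exp (-(w * t))‖ = t ^ q.re * Real.exp (-w.re * t ^ (1 : ℝ)) := by
    intro q w t ht
    rw [norm_mul, Complex.norm_cpow_eq_rpow_re_of_pos ht, Complex.norm_exp]
    simp
  have hmeas : ∀ (q : ℂ) (w : ℂ), AEStronglyMeasurable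
      (fun t : ℝ => (t : ℂ) ^ q * Complex.exp (-(w * t))) (volume.restrict (Ioi 0)) := by
    intro q w
    exact (by fun_prop : Measurable _).aestronglyMeasurable
  have hint : ∀ (q : ℂ) (w : ℂ), -1 < q.re → 0 < w.re →
      IntegrableOn (fun t : ℝ => (t : ℂ) ^ q * Complex.exp (-(w * t))) (Ioi 0) := by
    intro q w hq hw
    refine Integrable.mono' (integrableOn_rpow_mul_exp_neg_mul_rpow hq one_pos hw) (hmeas q w) ?_
    filter_upwards [ae_restrict_mem measurableSet_Ioi] with t ht
    exact (hnorm q w t ht).le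
  have h1 : DifferentiableOn ℂ (fun w : ℂ => ∫ t in Ioi (0 : ℝ), (t : ℂ) ^ (p - 1) *
      Complex.exp (-(w * t))) U := by
    intro w hw
    have hw' : 0 < w.re := hw
    refine (hasDerivAt_integral_of_dominated_loc_of_deriv_le (μ := volume.restrict (Ioi (0 : ℝ)))
      (F := fun w t => (t : ℂ) ^ (p - 1) * Complex.exp (-(w * t)))
      (F' := fun w t => (t : ℂ) ^ (p - 1) * (Complex.exp (-(w * t)) * -(t : ℂ)))
      (bound := fun t => t ^ p.re * Real.exp (-(w.re / 2) * t ^ (1 : ℝ)))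
      (s := Metric.ball w (w.re / 2))
      (Metric.ball_mem_nhds _ (by linarith)) (Eventually.of_forall fun w => hmeas _ w)
      (hint _ w (by simpa using hp) hw')
      (by exact (by fun_prop : Measurable _).aestronglyMeasurable) ?_
      (integrableOn_rpow_mul_exp_neg_mul_rpow (by linarith) one_pos (by linarith))
      ?_).2.differentiableAt.differentiableWithinAt
    · filter_upwards [ae_restrict_mem measurableSet_Ioi] with t ht v hv
      have ht' : (0 : ℝ) < t := ht
      have hv' : w.re / 2 ≤ v.re := by
        have := (Complex.abs_re_le_norm (v - w)).trans (mem_ball_iff_norm.1 hv).le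
        rw [Complex.sub_re, abs_le] at this
        linarith
      rw [← mul_assoc, norm_mul, hnorm _ _ t ht, norm_neg, Complex.norm_of_nonneg ht'.le,
        Complex.sub_re, Complex.one_re, Real.rpow_sub_one ht'.ne', Real.rpow_one]
      have : t ^ p.re / t * Real.exp (-v.re * t) * t = t ^ p.re * Real.exp (-v.re * t) := by
        field_simp
      rw [this]
      gcongr
    · refine ae_of_all _ fun t v _ => ?_
      refine HasDerivAt.const_mul _ ?_
      refine HasDerivAt.cexp ?_
      simpa using ((hasDerivAt_id v).mul_const (t : ℂ)).fun_neg
  have h2 : DifferentiableOn ℂ (fun w : ℂ => w ^ (-p) * Complex.Gamma p) U := by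
    intro w hw
    refine (DifferentiableAt.mul_const ?_ _).differentiableWithinAt
    exact differentiableAt_id.cpow_const (Or.inl hw)
  -- Identity theorem on the right half-plane: both sides are holomorphic in the rate and agree at
  -- the real points 1 + 1/(n+1), which accumulate at 1.
  refine (h1.analyticOnNhd hU).eqOn_of_preconnected_of_frequently_eq (h2.analyticOnNhd hU) hUc
    (z₀ := 1) (by simp [U]) ?_ hz
  have hseq : Tendsto (fun n : ℕ => ((1 + 1 / ((n : ℝ) + 1) : ℝ) : ℂ)) atTop (𝓝[≠] 1) := by
    rw [tendsto_nhdsWithin_iff]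
    constructor
    · have : Tendsto (fun n : ℕ => (1 + 1 / ((n : ℝ) + 1) : ℝ)) atTop (𝓝 (1 + 0)) :=
        tendsto_const_nhds.add tendsto_one_div_add_atTop_nhds_zero_nat
      have h := (Complex.continuous_ofReal.tendsto _).comp this
      simpa [Function.comp_def] using h
    · refine Eventually.of_forall fun n => ?_
      have h : (0 : ℝ) < 1 / ((n : ℝ) + 1) := by positivity
      intro h'
      have h' : ((1 + 1 / ((n : ℝ) + 1) : ℝ) : ℂ) = 1 := h'
      rw [← Complex.ofReal_one, Complex.ofReal_inj] at h'
      linarith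
  refine hseq.frequently (Eventually.frequently (Eventually.of_forall fun n => ?_))
  have hr : (0 : ℝ) < 1 + 1 / ((n : ℝ) + 1) := by positivity
  set r := 1 + 1 / ((n : ℝ) + 1)
  rw [Complex.integral_cpow_mul_exp_neg_mul_Ioi hp hr, one_div, Complex.inv_cpow _ _ (by
    rw [Complex.arg_ofReal_of_nonneg hr.le]; exact Real.pi_ne_zero.symm), Complex.cpow_neg]

end FractionalStefan

/-! ### Mellin transform of the Wright function. -/

namespace FractionalStefan

theorem ofReal_mul_exp_mul_I_cpow {R φ : ℝ} (hR : 0 < R) (hφ : |φ| < Real.pi) (q : ℂ) :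
    ((R : ℂ) * Complex.exp ((φ : ℂ) * Complex.I)) ^ q =
      (R : ℂ) ^ q * Complex.exp ((φ : ℂ) * Complex.I * q) := by
  have hR' : (R : ℂ) ≠ 0 := Complex.ofReal_ne_zero.2 hR.ne'
  rw [abs_lt] at hφ
  rw [Complex.cpow_def_of_ne_zero (mul_ne_zero hR' (Complex.exp_ne_zero _)),
    Complex.cpow_def_of_ne_zero hR', Complex.log_ofReal_mul hR (Complex.exp_ne_zero _),
    Complex.log_exp (by simpa using hφ.1) (by simpa using hφ.2.le), ← Complex.exp_add,
    Complex.ofReal_log hR.le]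
  congr 1
  ring

theorem integrableOn_cpow_mul_exp_neg_mul {p z : ℂ} (hp : 0 < p.re) (hz : 0 < z.re) :
    IntegrableOn (fun t : ℝ => (t : ℂ) ^ (p - 1) * Complex.exp (-(z * t))) (Ioi 0) := by
  refine Integrable.mono' (integrableOn_rpow_mul_exp_neg_mul_rpow (s := p.re - 1) (by linarith)
    one_pos hz) (by exact (by fun_prop : Measurable _).aestronglyMeasurable) ?_
  filter_upwards [ae_restrict_mem measurableSet_Ioi] with t ht
  rw [norm_mul, Complex.norm_cpow_eq_rpow_re_of_pos ht, Complex.norm_exp]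
  simp

/-- The integrand is a combination of two exponentials with complex rates R e^(±iθ). Their real
parts are positive because |θ| < π/2, so the complex Gamma integral applies to each. -/
theorem mellin_exp_mul_sin {p : ℂ} (hp : 0 < p.re) {R θ : ℝ} (hR : 0 < R) (hθ : |θ| < Real.pi / 2)
    (β : ℝ) :
    ∫ y in Ioi (0 : ℝ), (y : ℂ) ^ (p - 1) *
      ((Real.exp (-(y * R * Real.cos θ)) * Real.sin (β + y * R * Real.sin θ) : ℝ) : ℂ) =
    Complex.Gamma p * (R : ℂ) ^ (-p) * Complex.sin (β + θ * p) := by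
  have hcos : ∀ φ : ℝ, |φ| < Real.pi / 2 →
      0 < ((R : ℂ) * Complex.exp ((φ : ℂ) * Complex.I)).re := by
    intro φ hφ
    rw [Complex.re_ofReal_mul, Complex.exp_ofReal_mul_I_re]
    exact mul_pos hR (Real.cos_pos_of_mem_Ioo (abs_lt.1 hφ))
  have hθ' : |-θ| < Real.pi / 2 := by rwa [abs_neg]
  have hexp : ∀ y : ℝ, (y : ℂ) ^ (p - 1) *
      ((Real.exp (-(y * R * Real.cos θ)) * Real.sin (β + y * R * Real.sin θ) : ℝ) : ℂ) =
      Complex.I / 2 * (Complex.exp (-(β * Complex.I)) *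
        ((y : ℂ) ^ (p - 1) * Complex.exp (-((R : ℂ) * Complex.exp ((θ : ℂ) * Complex.I) * y))) -
        Complex.exp (β * Complex.I) *
        ((y : ℂ) ^ (p - 1) *
          Complex.exp (-((R : ℂ) * Complex.exp (((-θ : ℝ) : ℂ) * Complex.I) * y)))) := by
    intro y
    push_cast
    rw [Complex.sin, Complex.exp_mul_I θ, Complex.exp_mul_I (-θ), Complex.cos_neg, Complex.sin_neg]
    have h1 : Complex.exp (-(β * Complex.I)) *
        ((y : ℂ) ^ (p - 1) * Complex.exp (-((R : ℂ) * (Complex.cos θ + Complex.sin θ * Complex.I) * y))) =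
        (y : ℂ) ^ (p - 1) * (Complex.exp (-(y * R * Complex.cos θ)) *
          Complex.exp (-(β + y * R * Complex.sin θ) * Complex.I)) := by
      rw [← Complex.exp_add, mul_left_comm, ← Complex.exp_add]
      ring_nf
    have h2 : Complex.exp (β * Complex.I) *
        ((y : ℂ) ^ (p - 1) * Complex.exp (-((R : ℂ) * (Complex.cos θ + -Complex.sin θ * Complex.I) * y))) =
        (y : ℂ) ^ (p - 1) * (Complex.exp (-(y * R * Complex.cos θ)) *
          Complex.exp ((β + y * R * Complex.sin θ) * Complex.I)) := by
      rw [← Complex.exp_add, mul_left_comm, ← Complex.exp_add]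
      ring_nf
    rw [h1, h2]
    ring
  simp_rw [hexp]
  have hpi : |θ| < Real.pi := by linarith [abs_nonneg θ]
  rw [integral_const_mul, integral_sub
    ((integrableOn_cpow_mul_exp_neg_mul hp (hcos θ hθ)).const_mul _)
    ((integrableOn_cpow_mul_exp_neg_mul hp (hcos (-θ) hθ')).const_mul _),
    integral_const_mul, integral_const_mul, integral_cpow_mul_exp_neg_mul hp (hcos θ hθ),
    integral_cpow_mul_exp_neg_mul hp (hcos (-θ) hθ'), ofReal_mul_exp_mul_I_cpow hR hpi,
    ofReal_mul_exp_mul_I_cpow hR (by rwa [abs_neg]), Complex.sin]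
  have h1 : Complex.exp (-(β + θ * p) * Complex.I) =
      Complex.exp (-(β * Complex.I)) * Complex.exp ((θ : ℂ) * Complex.I * -p) := by
    rw [← Complex.exp_add]; ring_nf
  have h2 : Complex.exp ((β + θ * p) * Complex.I) =
      Complex.exp (β * Complex.I) * Complex.exp (((-θ : ℝ) : ℂ) * Complex.I * -p) := by
    rw [← Complex.exp_add]; push_cast; ring_nf
  rw [h1, h2]
  ring

/-- The Mellin transform of the Wright function. -/
theorem hasMellin_wright {ν b : ℝ} (hν0 : 0 < ν) (hν : ν < 1 / 2) (hb0 : 0 ≤ b) {p : ℂ}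
    (hp : 0 < p.re) (hbp : b + ν * p.re < 1) :
    HasMellin (fun y : ℝ => ((wright (-y) (-ν) b : ℝ) : ℂ)) p
      (Complex.Gamma p / Complex.Gamma (b + ν * p)) := by
  have hb : b < 1 := by nlinarith
  set c := Real.cos (Real.pi * ν)
  have hc : 0 < c := cos_pi_mul_pos hν0.le hν
  let H : ℝ × ℝ → ℂ := fun q => (q.1 : ℂ) ^ (p - 1) * ((q.2 ^ (-b) * Real.exp (-q.2) *
      (Real.exp (-(q.1 * q.2 ^ ν * c)) *
        Real.sin (Real.pi * b + q.1 * q.2 ^ ν * Real.sin (Real.pi * ν))) : ℝ) : ℂ)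
  -- `G` majorises the double integrand by dropping the sine. Its y-integral is a constant times
  -- r^(-(b + ν Re p)) e^(-r), integrable because b + ν Re p < 1; this justifies Fubini.
  let G : ℝ × ℝ → ℝ := fun q => q.2 ^ (-b) * Real.exp (-q.2) *
    (q.1 ^ (p.re - 1) * Real.exp (-(q.2 ^ ν * c * q.1)))
  have hGi : ∀ r : ℝ, 0 < r → ∫ y in Ioi (0 : ℝ), y ^ (p.re - 1) * Real.exp (-(r ^ ν * c * y)) =
      r ^ (-(ν * p.re)) * (c ^ (-p.re) * Real.Gamma p.re) := by
    intro r hr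
    have h1 : 0 < r ^ ν := by positivity
    rw [Real.integral_rpow_mul_exp_neg_mul_Ioi hp (by positivity), one_div,
      Real.inv_rpow (by positivity), ← Real.rpow_neg (by positivity), Real.mul_rpow h1.le hc.le,
      ← Real.rpow_mul hr.le]
    ring_nf
  have hG : Integrable G ((volume.restrict (Ioi 0)).prod (volume.restrict (Ioi 0))) := by
    rw [integrable_prod_iff' (by exact (by fun_prop : Measurable G).aestronglyMeasurable)]
    constructor
    · filter_upwards [ae_restrict_mem measurableSet_Ioi] with r hr
      have hr' : (0 : ℝ) < r := hr
      have h : IntegrableOn (fun y : ℝ => y ^ (p.re - 1) * Real.exp (-(r ^ ν * c * y))) (Ioi 0) := by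
        simpa using integrableOn_rpow_mul_exp_neg_mul_rpow (s := p.re - 1) (by linarith) one_pos
          (show 0 < r ^ ν * c by positivity)
      exact h.const_mul (r ^ (-b) * Real.exp (-r))
    · have hk : IntegrableOn (fun r : ℝ => r ^ (-(b + ν * p.re)) * Real.exp (-r)) (Ioi 0) := by
        simpa using integrableOn_kernel_mul_exp hν0.le hν.le (b := b + ν * p.re) (x := 0) hbp le_rfl
      refine (hk.mul_const (c ^ (-p.re) * Real.Gamma p.re)).congr ?_
      filter_upwards [ae_restrict_mem measurableSet_Ioi] with r hr
      have hr' : (0 : ℝ) < r := hr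
      have : ∫ y in Ioi (0 : ℝ), ‖G (y, r)‖ = ∫ y in Ioi (0 : ℝ), G (y, r) := by
        refine setIntegral_congr_fun measurableSet_Ioi fun y hy => ?_
        have hy' : (0 : ℝ) < y := hy
        exact Real.norm_of_nonneg (by positivity)
      have h2 : ∫ y in Ioi (0 : ℝ), G (y, r) = r ^ (-b) * Real.exp (-r) *
          ∫ y in Ioi (0 : ℝ), y ^ (p.re - 1) * Real.exp (-(r ^ ν * c * y)) :=
        integral_const_mul (r ^ (-b) * Real.exp (-r)) _
      rw [this, h2, hGi r hr', neg_add, Real.rpow_add hr']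
      ring
  have hH : Integrable H ((volume.restrict (Ioi 0)).prod (volume.restrict (Ioi 0))) := by
    refine hG.mono' (by exact (by fun_prop : Measurable H).aestronglyMeasurable) ?_
    rw [Measure.prod_restrict]
    filter_upwards [ae_restrict_mem (measurableSet_Ioi.prod measurableSet_Ioi)] with q hq
    have h1 : 0 < q.1 := hq.1
    have h2 : 0 < q.2 := hq.2
    simp only [H, G]
    rw [norm_mul, Complex.norm_cpow_eq_rpow_re_of_pos h1, Complex.norm_real, Real.norm_eq_abs,
      abs_mul, abs_mul (Real.exp _), abs_of_pos (by positivity : 0 < q.2 ^ (-b) * Real.exp (-q.2)),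
      Real.abs_exp, Complex.sub_re, Complex.one_re, mul_left_comm,
      show q.1 * q.2 ^ ν * c = q.2 ^ ν * c * q.1 by ring]
    refine mul_le_mul_of_nonneg_left (mul_le_mul_of_nonneg_left ?_ (by positivity)) (by positivity)
    exact mul_le_of_le_one_right (Real.exp_pos _).le (Real.abs_sin_le_one _)
  have hf : ∀ y : ℝ, (y : ℂ) ^ (p - 1) • ((wright (-y) (-ν) b : ℝ) : ℂ) =
      (Real.pi : ℂ)⁻¹ * ∫ r in Ioi (0 : ℝ), H (y, r) := by
    intro y
    have h : ∫ r in Ioi (0 : ℝ), H (y, r) = (y : ℂ) ^ (p - 1) *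
        ∫ r in Ioi (0 : ℝ), ((r ^ (-b) * Real.exp (-r) * (Real.exp (-(y * r ^ ν * c)) *
          Real.sin (Real.pi * b + y * r ^ ν * Real.sin (Real.pi * ν))) : ℝ) : ℂ) :=
      integral_const_mul ((y : ℂ) ^ (p - 1)) _
    rw [h, wright_eq_integral hν0.le hν.le hb, integral_complex_ofReal, smul_eq_mul]
    push_cast
    ring
  have hconv : MellinConvergent (fun y : ℝ => ((wright (-y) (-ν) b : ℝ) : ℂ)) p := by
    rw [MellinConvergent]
    simp_rw [hf]
    exact hH.integral_prod_left.const_mul _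
  refine ⟨hconv, ?_⟩
  rw [mellin]
  simp_rw [hf]
  rw [integral_const_mul, integral_integral_swap (f := fun y r => H (y, r)) hH]
  have hθ : |Real.pi * ν| < Real.pi / 2 := by
    rw [abs_of_pos (by positivity)]
    nlinarith [Real.pi_pos]
  have hinner : ∀ r ∈ Ioi (0 : ℝ), ∫ y in Ioi (0 : ℝ), H (y, r) =
      Complex.Gamma p * Complex.sin (Real.pi * (b + ν * p)) *
        (((Real.exp (-r) : ℝ) : ℂ) * (r : ℂ) ^ ((1 - (b + ν * p)) - 1)) := by
    intro r hr
    have hr' : (0 : ℝ) < r := hr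
    have hr'' : (r : ℂ) ≠ 0 := Complex.ofReal_ne_zero.2 hr'.ne'
    have h1 := mellin_exp_mul_sin hp (R := r ^ ν) (by positivity) hθ (Real.pi * b)
    have h2 : ∫ y in Ioi (0 : ℝ), H (y, r) = ((r ^ (-b) * Real.exp (-r) : ℝ) : ℂ) *
        ∫ y in Ioi (0 : ℝ), (y : ℂ) ^ (p - 1) * ((Real.exp (-(y * r ^ ν * Real.cos (Real.pi * ν))) *
          Real.sin (Real.pi * b + y * r ^ ν * Real.sin (Real.pi * ν)) : ℝ) : ℂ) := by
      rw [← integral_const_mul]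
      refine integral_congr_ae (ae_of_all _ fun y => ?_)
      simp only [H, c]
      push_cast
      ring
    have h3 : ((r ^ ν : ℝ) : ℂ) ^ (-p) = (r : ℂ) ^ (-(ν * p)) := by
      rw [Complex.cpow_def_of_ne_zero (Complex.ofReal_ne_zero.2 (by positivity)),
        Complex.cpow_def_of_ne_zero hr'', ← Complex.ofReal_log (by positivity),
        ← Complex.ofReal_log hr'.le, Real.log_rpow hr']
      push_cast
      ring_nf
    rw [h2, h1, h3, show 1 - ((b : ℂ) + ν * p) - 1 = ((-b : ℝ) : ℂ) + -(ν * p) by push_cast; ring,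
      Complex.cpow_add _ _ hr'', Complex.ofReal_mul, Complex.ofReal_cpow hr'.le,
      show ((Real.pi * b : ℝ) : ℂ) + ((Real.pi * ν : ℝ) : ℂ) * p = Real.pi * (b + ν * p) by
        push_cast; ring]
    ring
  have hre : ((b : ℂ) + ν * p).re = b + ν * p.re := by simp
  rw [setIntegral_congr_fun measurableSet_Ioi hinner, integral_const_mul,
    ← Complex.GammaIntegral, ← Complex.Gamma_eq_integral (by
      rw [Complex.sub_re, hre, Complex.one_re]; linarith)]
  have hpos : 0 < b + ν * p.re := by positivity
  -- The r-integral has left Γ(1 - b - νp) sin(π(b + νp)) / π, which reflection collapses to 1/Γ(b +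
  -- νp).
  have h1 := Complex.Gamma_mul_Gamma_one_sub ((b : ℂ) + ν * p)
  have hg1 : Complex.Gamma ((b : ℂ) + ν * p) ≠ 0 :=
    Complex.Gamma_ne_zero_of_re_pos (by rwa [hre])
  have hg2 : Complex.Gamma (1 - ((b : ℂ) + ν * p)) ≠ 0 :=
    Complex.Gamma_ne_zero_of_re_pos (by rw [Complex.sub_re, hre, Complex.one_re]; linarith)
  have hpi : (Real.pi : ℂ) ≠ 0 := Complex.ofReal_ne_zero.2 Real.pi_ne_zero
  have hs : Complex.sin (Real.pi * (b + ν * p)) ≠ 0 := by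
    intro h0
    rw [h0, div_zero] at h1
    exact mul_ne_zero hg1 hg2 h1
  rw [eq_div_iff hs] at h1
  rw [eq_div_iff hg1, inv_mul_eq_div, div_mul_eq_mul_div, div_eq_iff hpi]
  linear_combination Complex.Gamma p * h1

end FractionalStefan

/-! ### Fractional integrals of the Wright function by Mellin inversion. -/

namespace FractionalStefan

theorem continuous_wright {ν b : ℝ} (hν0 : 0 ≤ ν) (hν : ν ≤ 1 / 2) (hb : b - ν < 1) :
    Continuous fun z => wright z (-ν) b :=
  continuous_iff_continuousAt.2 fun z => (hasDerivAt_wright hν0 hν hb z).continuousAt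

theorem integrableOn_beta {u v : ℝ} (hu : 0 < u) (hv : 0 < v) :
    IntegrableOn (fun τ : ℝ => τ ^ (u - 1) * (1 - τ) ^ (v - 1)) (Ioo 0 1) := by
  have h := Complex.betaIntegral_convergent (u := u) (v := v) (by simpa) (by simpa)
  rw [intervalIntegrable_iff_integrableOn_Ioo_of_le zero_le_one] at h
  refine h.norm.congr ?_
  filter_upwards [ae_restrict_mem measurableSet_Ioo] with τ hτ
  have h1 : (1 - (τ : ℂ)) = ((1 - τ : ℝ) : ℂ) := by push_cast; rfl
  rw [norm_mul, h1, Complex.norm_cpow_eq_rpow_re_of_pos hτ.1,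
    Complex.norm_cpow_eq_rpow_re_of_pos (sub_pos.2 hτ.2)]
  simp

theorem integrableOn_rpow_mul_wright {ν γ y : ℝ} (hν0 : 0 < ν) (hν : ν < 1 / 2) (hγ : 0 < γ)
    (hy : 0 < y) :
    IntegrableOn (fun τ : ℝ => (1 - τ) ^ (γ - 1) * (τ⁻¹ * wright (-(y * τ ^ (-ν))) (-ν) 0))
      (Ioo 0 1) := by
  obtain ⟨C, hC0, hC⟩ := exists_abs_wright_zero_le hν0.le hν
  have hm : Measurable fun z => wright z (-ν) 0 :=
    (continuous_wright hν0.le hν.le (by linarith)).measurable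
  refine Integrable.mono' ((integrableOn_beta hν0 hγ).mul_const (C / y))
    (by exact (by fun_prop : Measurable _).aestronglyMeasurable) ?_
  filter_upwards [ae_restrict_mem measurableSet_Ioo] with τ hτ
  have hτ0 := hτ.1
  have h1 : 0 < 1 - τ := sub_pos.2 hτ.2
  have h2 := hC (y * τ ^ (-ν)) (by positivity)
  rw [Real.norm_eq_abs, abs_mul, abs_mul, abs_of_pos (by positivity : 0 < (1 - τ) ^ (γ - 1)),
    abs_of_pos (by positivity : 0 < τ⁻¹)]
  calc (1 - τ) ^ (γ - 1) * (τ⁻¹ * |_|) ≤ (1 - τ) ^ (γ - 1) * (τ⁻¹ * (C / (y * τ ^ (-ν)))) := by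
        gcongr
    _ = _ := by
        rw [Real.rpow_neg hτ0.le, Real.rpow_sub_one hτ0.ne']
        field_simp

/-- Mellin inversion at a point requires continuity there. Restricting to arguments above y/2 makes
the 1/y bound uniform. -/
theorem continuousAt_fractional_integral {ν γ y : ℝ} (hν0 : 0 < ν) (hν : ν < 1 / 2) (hγ : 0 < γ)
    (hy : 0 < y) :
    ContinuousAt (fun y : ℝ => ∫ τ in Ioo (0 : ℝ) 1,
      (1 - τ) ^ (γ - 1) * (τ⁻¹ * wright (-(y * τ ^ (-ν))) (-ν) 0)) y := by
  obtain ⟨C, hC0, hC⟩ := exists_abs_wright_zero_le hν0.le hν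
  have hcont := continuous_wright hν0.le hν.le (b := 0) (by linarith)
  have hm : Measurable fun z => wright z (-ν) 0 := hcont.measurable
  refine continuousAt_of_dominated
    (bound := fun τ => τ ^ (ν - 1) * (1 - τ) ^ (γ - 1) * (C / (y / 2)))
    (Eventually.of_forall fun y => by exact (by fun_prop : Measurable _).aestronglyMeasurable)
    ?_ ((integrableOn_beta hν0 hγ).mul_const _) ?_
  · filter_upwards [lt_mem_nhds (show y / 2 < y by linarith)] with x hx
    have hx0 : 0 < x := by linarith
    filter_upwards [ae_restrict_mem measurableSet_Ioo] with τ hτ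
    have hτ0 := hτ.1
    have h1 : 0 < 1 - τ := sub_pos.2 hτ.2
    have h2 := hC (x * τ ^ (-ν)) (by positivity)
    rw [Real.norm_eq_abs, abs_mul, abs_mul, abs_of_pos (by positivity : 0 < (1 - τ) ^ (γ - 1)),
      abs_of_pos (by positivity : 0 < τ⁻¹)]
    calc (1 - τ) ^ (γ - 1) * (τ⁻¹ * |_|) ≤
          (1 - τ) ^ (γ - 1) * (τ⁻¹ * (C / ((y / 2) * τ ^ (-ν)))) := by
          refine mul_le_mul_of_nonneg_left (mul_le_mul_of_nonneg_left (h2.trans ?_)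
            (by positivity)) (by positivity)
          gcongr
      _ = _ := by
          rw [Real.rpow_neg hτ0.le, Real.rpow_sub_one hτ0.ne']
          field_simp
  · refine ae_of_all _ fun τ => ?_
    have h : Continuous fun x : ℝ =>
      (1 - τ) ^ (γ - 1) * (τ⁻¹ * wright (-(x * τ ^ (-ν))) (-ν) 0) := by fun_prop
    exact h.continuousAt

/-- Dilation by τ^(-ν) multiplies the Mellin transform by τ^(νp). What remains is the beta integral
B(νp, γ), whose factor Γ(νp) cancels the denominator of the transform of W(-y, -ν, 0). -/
theorem hasMellin_fractional_integral {ν γ : ℝ} (hν0 : 0 < ν) (hν : ν < 1 / 2) (hγ : 0 < γ)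
    {p : ℂ} (hp : 0 < p.re) (hνp : ν * p.re < 1) :
    HasMellin (fun y : ℝ => ((∫ τ in Ioo (0 : ℝ) 1,
      (1 - τ) ^ (γ - 1) * (τ⁻¹ * wright (-(y * τ ^ (-ν))) (-ν) 0) : ℝ) : ℂ)) p
      (Complex.Gamma γ * (Complex.Gamma p / Complex.Gamma (γ + ν * p))) := by
  have hcont := continuous_wright hν0.le hν.le (b := 0) (by linarith)
  have hm : Measurable fun z => wright z (-ν) 0 := hcont.measurable
  obtain ⟨hconv, hmel⟩ := hasMellin_wright hν0 hν le_rfl hp (by linarith)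
  let k : ℝ → ℝ := fun τ => (1 - τ) ^ (γ - 1) * τ⁻¹
  let H : ℝ × ℝ → ℂ := fun q => (k q.2 : ℂ) *
    ((q.1 : ℂ) ^ (p - 1) * ((wright (-(q.2 ^ (-ν) * q.1)) (-ν) 0 : ℝ) : ℂ))
  have hHm : Measurable H := by fun_prop
  have hH : Integrable H ((volume.restrict (Ioi 0)).prod (volume.restrict (Ioo 0 1))) := by
    rw [integrable_prod_iff' hHm.aestronglyMeasurable]
    constructor
    · filter_upwards [ae_restrict_mem measurableSet_Ioo] with τ hτ
      have hτ0 := hτ.1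
      have h := (MellinConvergent.comp_mul_left (f := fun y : ℝ => ((wright (-y) (-ν) 0 : ℝ) : ℂ))
        (s := p) (show 0 < τ ^ (-ν) by positivity)).2 hconv
      exact Integrable.const_mul h (k τ : ℂ)
    · let A : ℝ := ∫ y in Ioi (0 : ℝ), y ^ (p.re - 1) * |wright (-y) (-ν) 0|
      refine ((integrableOn_beta (mul_pos hν0 hp) hγ).mul_const A).congr ?_
      filter_upwards [ae_restrict_mem measurableSet_Ioo] with τ hτ
      have hτ0 := hτ.1
      have h1 : 0 < 1 - τ := sub_pos.2 hτ.2
      have hk : 0 < k τ := by positivity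
      have ha : 0 < τ ^ (-ν) := by positivity
      have e1 : ∫ y in Ioi (0 : ℝ), ‖H (y, τ)‖ = ∫ y in Ioi (0 : ℝ),
          (k τ * (τ ^ (-ν)) ^ (1 - p.re)) * ((fun y => y ^ (p.re - 1) * |wright (-y) (-ν) 0|)
            (τ ^ (-ν) * y)) := by
        refine setIntegral_congr_fun measurableSet_Ioi fun y hy => ?_
        have hy' : (0 : ℝ) < y := hy
        simp only [H]
        rw [norm_mul, norm_mul, Complex.norm_cpow_eq_rpow_re_of_pos hy', Complex.norm_real,
          Complex.norm_real, Real.norm_of_nonneg hk.le, Real.norm_eq_abs, Complex.sub_re,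
          Complex.one_re, Real.mul_rpow ha.le hy'.le, show 1 - p.re = -(p.re - 1) by ring,
          Real.rpow_neg ha.le (p.re - 1)]
        have : (τ ^ (-ν)) ^ (p.re - 1) ≠ 0 := by positivity
        field_simp
      have e2 := integral_comp_mul_left_Ioi (fun y => y ^ (p.re - 1) * |wright (-y) (-ν) 0|) 0 ha
      rw [mul_zero] at e2
      rw [e1, integral_const_mul, e2, smul_eq_mul]
      have e3 : τ ^ (ν * p.re - 1) * (1 - τ) ^ (γ - 1) =
          k τ * (τ ^ (-ν)) ^ (1 - p.re) * (τ ^ (-ν))⁻¹ := by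
        simp only [k]
        rw [← Real.rpow_neg hτ0.le, ← Real.rpow_mul hτ0.le, ← Real.rpow_neg_one τ]
        have : τ ^ (ν * p.re - 1) = τ ^ (-1 : ℝ) * τ ^ (-ν * (1 - p.re)) * τ ^ (-(-ν)) := by
          rw [← Real.rpow_add hτ0, ← Real.rpow_add hτ0]
          ring_nf
        rw [this]
        ring
      rw [e3]
      ring
  have hf : ∀ y : ℝ, (y : ℂ) ^ (p - 1) • ((∫ τ in Ioo (0 : ℝ) 1,
      (1 - τ) ^ (γ - 1) * (τ⁻¹ * wright (-(y * τ ^ (-ν))) (-ν) 0) : ℝ) : ℂ) =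
      ∫ τ in Ioo (0 : ℝ) 1, H (y, τ) := by
    intro y
    rw [← integral_complex_ofReal, smul_eq_mul, ← integral_const_mul]
    refine integral_congr_ae (ae_of_all _ fun τ => ?_)
    simp only [H, k]
    rw [mul_comm y]
    push_cast
    ring
  refine ⟨?_, ?_⟩
  · rw [MellinConvergent]
    simp_rw [hf]
    exact hH.integral_prod_left
  rw [mellin]
  simp_rw [hf]
  rw [integral_integral_swap (f := fun y τ => H (y, τ)) hH]
  have hinner : ∀ τ ∈ Ioo (0 : ℝ) 1, ∫ y in Ioi (0 : ℝ), H (y, τ) =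
      ((τ : ℂ) ^ (ν * p - 1) * (1 - (τ : ℂ)) ^ ((γ : ℂ) - 1)) *
        (Complex.Gamma p / Complex.Gamma ((0 : ℝ) + ν * p)) := by
    intro τ hτ
    have hτ0 := hτ.1
    have hτ' : (τ : ℂ) ≠ 0 := Complex.ofReal_ne_zero.2 hτ0.ne'
    have ha : 0 < τ ^ (-ν) := by positivity
    have h1 := mellin_comp_mul_left (fun y : ℝ => ((wright (-y) (-ν) 0 : ℝ) : ℂ)) p ha
    rw [hmel, mellin] at h1
    have h2 : ∫ y in Ioi (0 : ℝ), H (y, τ) = (k τ : ℂ) * ∫ y in Ioi (0 : ℝ), (y : ℂ) ^ (p - 1) •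
        ((wright (-(τ ^ (-ν) * y)) (-ν) 0 : ℝ) : ℂ) := integral_const_mul (k τ : ℂ) _
    have h3 : ((τ ^ (-ν) : ℝ) : ℂ) ^ (-p) = (τ : ℂ) ^ (ν * p) := by
      rw [Complex.cpow_def_of_ne_zero (Complex.ofReal_ne_zero.2 ha.ne'),
        Complex.cpow_def_of_ne_zero hτ', ← Complex.ofReal_log ha.le, ← Complex.ofReal_log hτ0.le,
        Real.log_rpow hτ0]
      push_cast
      ring_nf
    have h4 : (k τ : ℂ) = (1 - (τ : ℂ)) ^ ((γ : ℂ) - 1) * (τ : ℂ)⁻¹ := by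
      simp only [k]
      rw [Complex.ofReal_mul, Complex.ofReal_cpow (sub_pos.2 hτ.2).le]
      push_cast
      rfl
    rw [h2, h1, h3, h4, Complex.cpow_sub _ _ hτ', Complex.cpow_one, smul_eq_mul]
    ring
  have hνp' : 0 < (ν * p).re := by rw [Complex.re_ofReal_mul]; positivity
  rw [setIntegral_congr_fun measurableSet_Ioo hinner, integral_mul_const,
    ← integral_Ioc_eq_integral_Ioo, ← intervalIntegral.integral_of_le zero_le_one,
    ← Complex.betaIntegral, Complex.betaIntegral_eq_Gamma_mul_div _ _ hνp' (by simpa)]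
  have hg := Complex.Gamma_ne_zero_of_re_pos hνp'
  rw [Complex.ofReal_zero, zero_add, add_comm (γ : ℂ)]
  field_simp

/-- The fractional integral, of order `γ`, of `τ ↦ τ⁻¹ W(-y τ^(-ν), -ν, 0)` at time `1`. -/
theorem fractional_integral_wright {ν γ y : ℝ} (hν0 : 0 < ν) (hν : ν < 1 / 2) (hγ : 0 < γ)
    (hγν : γ + ν ≤ 1) (hy : 0 < y) :
    ∫ τ in Ioo (0 : ℝ) 1, (1 - τ) ^ (γ - 1) * (τ⁻¹ * wright (-(y * τ ^ (-ν))) (-ν) 0) =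
      Real.Gamma γ * wright (-y) (-ν) γ := by
  let g : ℝ → ℝ := fun y => ∫ τ in Ioo (0 : ℝ) 1,
    (1 - τ) ^ (γ - 1) * (τ⁻¹ * wright (-(y * τ ^ (-ν))) (-ν) 0)
  let h : ℝ → ℂ := fun y => (g y : ℂ) - (Real.Gamma γ : ℂ) • ((wright (-y) (-ν) γ : ℝ) : ℂ)
  -- The line Re p = 1/2 is admissible because γ + ν ≤ 1 gives γ + ν/2 < 1. The transform of the
  -- difference vanishes on it, so vertical integrability is trivial and inversion returns 0.
  have hM : ∀ p : ℂ, p.re = 1 / 2 → HasMellin h p 0 := by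
    intro p hp
    have h1 := hasMellin_fractional_integral hν0 hν hγ (p := p) (by rw [hp]; norm_num)
      (by rw [hp]; linarith)
    have h2 := hasMellin_wright hν0 hν hγ.le (p := p) (by rw [hp]; norm_num) (by rw [hp]; linarith)
    have h3 := hasMellin_const_smul h2.1 (Real.Gamma γ : ℂ)
    have h4 := hasMellin_sub h1.1 h3.1
    rw [h1.2, h3.2, h2.2, smul_eq_mul, Complex.Gamma_ofReal, sub_self] at h4
    exact h4
  have hzero : (fun t : ℝ => mellin h ((1 / 2 : ℝ) + t * Complex.I)) = fun _ => 0 := by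
    funext t
    exact (hM _ (by simp)).2
  have hcont : ContinuousAt h y := by
    have h1 : ContinuousAt g y := continuousAt_fractional_integral hν0 hν hγ hy
    have h2 : Continuous fun y : ℝ => (Real.Gamma γ : ℂ) • ((wright (-y) (-ν) γ : ℝ) : ℂ) := by
      have := continuous_wright hν0.le hν.le (b := γ) (by linarith)
      fun_prop
    exact (Complex.continuous_ofReal.continuousAt.comp h1).sub h2.continuousAt
  have hinv := mellinInv_mellin_eq (1 / 2) h hy (hM _ (by simp)).1
    (by rw [Complex.VerticalIntegrable, hzero]; exact integrable_zero _ _ _) hcont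
  have h0 : h y = 0 := by
    rw [← hinv, mellinInv]
    have : ∀ t : ℝ, mellin h ((1 / 2 : ℝ) + t * Complex.I) = 0 := fun t => congrFun hzero t
    simp only [this, smul_zero, integral_zero]
  have h1 : (g y : ℂ) = ((Real.Gamma γ * wright (-y) (-ν) γ : ℝ) : ℂ) := by
    rw [Complex.ofReal_mul]
    exact sub_eq_zero.1 h0
  exact Complex.ofReal_injective h1

end FractionalStefan

/-! ### Extremum principle; positivity and monotonicity of the Mainardi function. -/

namespace FractionalStefan

theorem hasDerivAt_wright_neg {ν b : ℝ} (hν0 : 0 ≤ ν) (hν : ν ≤ 1 / 2) (hb : b - ν < 1) (y : ℝ) :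
    HasDerivAt (fun y => wright (-y) (-ν) b) (-wright (-y) (-ν) (b - ν)) y := by
  have h := (hasDerivAt_wright hν0 hν hb (-y)).scomp y (hasDerivAt_neg y)
  simpa [Function.comp_def] using h

/-- The time derivative of `τ ↦ W(-x τ^(-ν), -ν, 1)`. -/
theorem hasDerivAt_wright_similarity {ν : ℝ} (hν0 : 0 < ν) (hν : ν ≤ 1 / 2) (x : ℝ) {τ : ℝ}
    (hτ : 0 < τ) :
    HasDerivAt (fun τ => wright (-(x * τ ^ (-ν))) (-ν) 1)
      (τ⁻¹ * wright (-(x * τ ^ (-ν))) (-ν) 0) τ := by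
  have h1 : HasDerivAt (fun τ : ℝ => x * τ ^ (-ν)) (x * (-ν * τ ^ (-ν - 1))) τ :=
    (Real.hasDerivAt_rpow_const (Or.inl hτ.ne')).const_mul x
  have h2 := (hasDerivAt_wright_neg hν0.le hν (b := 1) (by linarith) (x * τ ^ (-ν))).comp τ h1
  convert! h2 using 1
  rw [wright_zero_right hν0 hν, Real.rpow_sub_one hτ.ne']
  field_simp

/-- Since ν y M(y) = W(-y, -ν, 0) = O(1/y), the derivative -M is O(y⁻²), hence integrable at
infinity. The value of the limit is never needed. -/
theorem exists_tendsto_wright_one {ν : ℝ} (hν0 : 0 < ν) (hν : ν < 1 / 2) :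
    ∃ L : ℝ, Tendsto (fun y => wright (-y) (-ν) 1) atTop (𝓝 L) := by
  obtain ⟨C, hC0, hC⟩ := exists_abs_wright_zero_le hν0.le hν
  refine ⟨_, tendsto_limUnder_of_hasDerivAt_of_integrableOn_Ioi (a := 1)
    (fun y _ => hasDerivAt_wright_neg hν0.le hν.le (by linarith) y) ?_⟩
  have hcont := continuous_wright hν0.le hν.le (b := 1 - ν) (by linarith)
  have h := (integrableOn_Ioi_rpow_of_lt (a := -2) (by norm_num) (c := 1) one_pos).const_mul (C / ν)
  refine Integrable.mono' h (by fun_prop) ?_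
  filter_upwards [ae_restrict_mem measurableSet_Ioi] with y hy
  have hy0 : 0 < y := one_pos.trans hy
  have h1 := hC y hy0
  rw [wright_zero_right hν0 hν.le, abs_mul, neg_mul_neg, abs_of_pos (by positivity : 0 < ν * y)] at h1
  rw [norm_neg, Real.norm_eq_abs, Real.rpow_neg hy0.le]
  calc |wright (-y) (-ν) (1 - ν)| = (ν * y * |wright (-y) (-ν) (1 - ν)|) / (ν * y) := by
        field_simp
    _ ≤ (C / y) / (ν * y) := by gcongr
    _ = _ := by
        rw [show (2 : ℝ) = (2 : ℕ) by norm_num, Real.rpow_natCast]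
        field_simp

/-- An extremum principle for the Caputo derivative of order `ν` at time `1`: if `φ ≥ 0` vanishes at
`1` and has limit `l` at `0`, then the Caputo derivative of `φ` at `1` is at most `-l`, up to the
factor `1 / Γ(1 - ν)`. -/
theorem le_neg_integral_of_nonneg {ν l : ℝ} (hν0 : 0 < ν) (hν : ν < 1) {φ φ' : ℝ → ℝ}
    (hφ : ∀ τ ∈ Ioo (0 : ℝ) 1, 0 ≤ φ τ) (hφ1 : φ 1 = 0)
    (hderiv : ∀ τ ∈ Ioc (0 : ℝ) 1, HasDerivAt φ (φ' τ) τ) (hlim : Tendsto φ (𝓝[>] 0) (𝓝 l))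
    (hint : IntegrableOn (fun τ => (1 - τ) ^ (-ν) * φ' τ) (Ioo 0 1)) :
    l ≤ -∫ τ in Ioo (0 : ℝ) 1, (1 - τ) ^ (-ν) * φ' τ := by
  -- Integration by parts as an inequality: Ψ' equals -(1 - τ)^(-ν) φ' minus the nonnegative term ν
  -- (1 - τ)^(-ν-1) φ, and Ψ rises from -l at 0 to 0 at 1.
  let Ψ : ℝ → ℝ := fun τ => -((1 - τ) ^ (-ν) * φ τ)
  have hΨ : ∀ τ ∈ Ioo (0 : ℝ) 1, HasDerivAt Ψ
      (-((-1 * -ν * (1 - τ) ^ (-ν - 1)) * φ τ + (1 - τ) ^ (-ν) * φ' τ)) τ := by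
    intro τ hτ
    have h1 : (1 - τ) ≠ 0 := (sub_pos.2 hτ.2).ne'
    exact ((((hasDerivAt_id τ).const_sub 1).rpow_const (Or.inl h1)).mul
      (hderiv τ ⟨hτ.1, hτ.2.le⟩)).neg
  have hΨc : ContinuousOn Ψ (Ioo 0 1) := fun τ hτ => (hΨ τ hτ).continuousAt.continuousWithinAt
  have h0 : Tendsto Ψ (𝓝[>] 0) (𝓝 (-l)) := by
    have h1 : Tendsto (fun τ : ℝ => (1 - τ) ^ (-ν)) (𝓝[>] 0) (𝓝 1) := by
      have : ContinuousAt (fun τ : ℝ => (1 - τ) ^ (-ν)) 0 :=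
        (by fun_prop : ContinuousAt (fun τ : ℝ => 1 - τ) 0).rpow_const (by norm_num)
      have h := this.tendsto.mono_left (nhdsWithin_le_nhds (s := Ioi 0))
      simpa using h
    have h := (h1.mul hlim).neg
    rwa [one_mul] at h
  -- Differentiability at 1 with φ(1) = 0 gives φ = O(1 - τ), which beats the singular factor: Ψ =
  -- O((1 - τ)^(1-ν)).
  have h1 : Tendsto Ψ (𝓝[<] 1) (𝓝 0) := by
    have hd := hderiv 1 ⟨one_pos, le_rfl⟩
    have hO := hd.isBigO_sub.mono (nhdsWithin_le_nhds (s := Iio 1))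
    obtain ⟨B, hB⟩ := hO.bound
    have hz : Tendsto (fun τ : ℝ => B * (1 - τ) ^ (1 - ν)) (𝓝[<] 1) (𝓝 0) := by
      have : ContinuousAt (fun τ : ℝ => B * (1 - τ) ^ (1 - ν)) 1 :=
        continuousAt_const.mul ((by fun_prop : ContinuousAt (fun τ : ℝ => 1 - τ) 1).rpow_const
          (Or.inr (by linarith)))
      have h := this.tendsto.mono_left (nhdsWithin_le_nhds (s := Iio 1))
      have h2 : (0 : ℝ) ^ (1 - ν) = 0 := Real.zero_rpow (by linarith)
      simpa [h2] using h
    refine squeeze_zero_norm' ?_ hz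
    filter_upwards [hB, self_mem_nhdsWithin] with τ hτ hτ1
    have h3 : 0 < 1 - τ := sub_pos.2 hτ1
    simp only [Ψ]
    rw [hφ1, sub_zero, ← neg_sub 1 τ, norm_neg, Real.norm_of_nonneg h3.le] at hτ
    rw [norm_neg, norm_mul, Real.norm_of_nonneg (by positivity : 0 ≤ (1 - τ) ^ (-ν))]
    calc (1 - τ) ^ (-ν) * ‖φ τ‖ ≤ (1 - τ) ^ (-ν) * (B * (1 - τ)) := by gcongr
      _ = _ := by
        rw [sub_eq_add_neg 1 ν, Real.rpow_add h3, Real.rpow_one]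
        ring
  set g := extendFrom (Ioo 0 1) Ψ
  have hgc : ContinuousOn g (Icc 0 1) := continuousOn_Icc_extendFrom_Ioo hΨc h0 h1
  have hg0 : g 0 = -l := eq_lim_at_left_extendFrom_Ioo one_pos h0
  have hg1 : g 1 = 0 := eq_lim_at_right_extendFrom_Ioo one_pos h1
  have hgΨ : ∀ τ ∈ Ioo (0 : ℝ) 1, g τ = Ψ τ := extendFrom_extends hΨc
  have key := intervalIntegral.sub_le_integral_of_hasDeriv_right_of_le zero_le_one hgc
    (g' := fun τ => -((-1 * -ν * (1 - τ) ^ (-ν - 1)) * φ τ + (1 - τ) ^ (-ν) * φ' τ))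
    (φ := fun τ => -((1 - τ) ^ (-ν) * φ' τ))
    (fun τ hτ => ((hΨ τ hτ).congr_of_eventuallyEq
      (by filter_upwards [Ioo_mem_nhds hτ.1 hτ.2] with x hx using hgΨ x hx)).hasDerivWithinAt)
    ((integrableOn_Icc_iff_integrableOn_Ioo).2 hint.neg)
    (fun τ hτ => by
      have h3 : 0 < 1 - τ := sub_pos.2 hτ.2
      have h4 := hφ τ hτ
      have : 0 ≤ (-1 * -ν * (1 - τ) ^ (-ν - 1)) * φ τ := by
        rw [neg_mul_neg, one_mul]
        positivity
      linarith)
  rw [hg0, hg1, intervalIntegral.integral_of_le zero_le_one, integral_Ioc_eq_integral_Ioo,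
    integral_neg] at key
  linarith

/-- The extremum principle applied to `± W(-y, -ν, 1)`. -/
theorem wright_extremum {ν L ε y : ℝ} (hν0 : 0 < ν) (hν : ν < 1 / 2)
    (hL : Tendsto (fun y => wright (-y) (-ν) 1) atTop (𝓝 L)) (hy : 0 < y)
    (hmax : ∀ v, y ≤ v → ε * wright (-v) (-ν) 1 ≤ ε * wright (-y) (-ν) 1) :
    ε * (wright (-y) (-ν) 1 - L) ≤ ε * (Real.Gamma (1 - ν) * wright (-y) (-ν) (1 - ν)) := by
  have hfi := fractional_integral_wright hν0 hν (γ := 1 - ν) (by linarith) (by linarith) hy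
  have hint := integrableOn_rpow_mul_wright hν0 hν (γ := 1 - ν) (by linarith) hy
  rw [show 1 - ν - 1 = -ν by ring] at hfi hint
  -- Earlier times correspond to larger arguments, as y τ^(-ν) ≥ y, so only values beyond y are
  -- compared. As τ → 0 the argument tends to infinity, whence the limit L. The factor ε = ±1 will
  -- treat maxima and minima together.
  have key := le_neg_integral_of_nonneg (l := ε * (wright (-y) (-ν) 1 - L))
    (φ := fun τ => ε * (wright (-y) (-ν) 1 - wright (-(y * τ ^ (-ν))) (-ν) 1))
    (φ' := fun τ => ε * -(τ⁻¹ * wright (-(y * τ ^ (-ν))) (-ν) 0)) hν0 (by linarith)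
    (fun τ hτ => by
      have h1 : 1 ≤ τ ^ (-ν) :=
        Real.one_le_rpow_of_pos_of_le_one_of_nonpos hτ.1 hτ.2.le (by linarith)
      have := hmax (y * τ ^ (-ν)) (by nlinarith)
      rw [mul_sub]
      linarith)
    (by simp)
    (fun τ hτ => ((hasDerivAt_wright_similarity hν0 hν.le y hτ.1).const_sub _).const_mul ε)
    (by
      refine (tendsto_const_nhds.sub (hL.comp ?_)).const_mul ε
      exact (tendsto_rpow_neg_nhdsGT_zero (by linarith)).const_mul_atTop hy)
    (by
      refine (hint.const_mul (-ε)).congr (ae_of_all _ fun τ => ?_)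
      simp only
      ring)
  have e : ∫ τ in Ioo (0 : ℝ) 1, (1 - τ) ^ (-ν) * (ε * -(τ⁻¹ * wright (-(y * τ ^ (-ν))) (-ν) 0)) =
      -ε * ∫ τ in Ioo (0 : ℝ) 1, (1 - τ) ^ (-ν) * (τ⁻¹ * wright (-(y * τ ^ (-ν))) (-ν) 0) := by
    rw [← integral_const_mul]
    refine integral_congr_ae (ae_of_all _ fun τ => ?_)
    simp only
    ring
  rw [e, hfi] at key
  linarith

theorem exists_isMinOn_Ici {F : ℝ → ℝ} (hF : Continuous F) {L a x : ℝ}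
    (hL : Tendsto F atTop (𝓝 L)) (hx : a ≤ x) (hxL : F x < L) :
    ∃ y ∈ Ici a, IsMinOn F (Ici a) y := by
  refine hF.continuousOn.exists_isMinOn' isClosed_Ici (show x ∈ Ici a from hx) ?_
  have h := hL.eventually (lt_mem_nhds hxL)
  rw [cocompact_eq_atBot_atTop, inf_sup_right, eventually_sup]
  constructor
  · have : (atBot : Filter ℝ) ⊓ 𝓟 (Ici a) = ⊥ := by
      rw [← disjoint_iff]
      exact (disjoint_principal_right.2 (by
        filter_upwards [eventually_lt_atBot a] with z hz using not_le.2 hz))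
    rw [this]
    exact eventually_bot
  · exact (h.mono fun z hz => hz.le).filter_mono inf_le_left

theorem wright_sub_eq_zero_of_isLocalExtr {ν y : ℝ} (hν0 : 0 < ν) (hν : ν < 1 / 2)
    (h : IsLocalExtr (fun y => wright (-y) (-ν) 1) y) : wright (-y) (-ν) (1 - ν) = 0 := by
  have := h.hasDerivAt_eq_zero (hasDerivAt_wright_neg hν0.le hν.le (by linarith) y)
  linarith

/-- A value below L would produce a minimum v on [0, ∞). It is not at 0, where the value is 1, so
M(v) = 0; the extremum principle with ε = -1 then gives W(-v, -ν, 1) ≥ L, a contradiction. -/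
theorem le_wright_one {ν L : ℝ} (hν0 : 0 < ν) (hν : ν < 1 / 2)
    (hL : Tendsto (fun y => wright (-y) (-ν) 1) atTop (𝓝 L)) {y : ℝ} (hy : 0 ≤ y)
    (hy1 : wright (-y) (-ν) 1 < 1) : L ≤ wright (-y) (-ν) 1 := by
  by_contra! hlt
  have hcont : Continuous fun y => wright (-y) (-ν) 1 :=
    (continuous_wright hν0.le hν.le (by linarith)).comp continuous_neg
  obtain ⟨v, hv0, hv⟩ := exists_isMinOn_Ici hcont hL hy hlt
  have hvy : wright (-v) (-ν) 1 ≤ wright (-y) (-ν) 1 := hv hy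
  have hvpos : 0 < v := by
    refine lt_of_le_of_ne hv0 ?_
    rintro rfl
    rw [neg_zero, wright_zero_left, Real.Gamma_one] at hvy
    linarith
  have hM := wright_sub_eq_zero_of_isLocalExtr hν0 hν
    (Or.inl (hv.isLocalMin (Ici_mem_nhds hvpos)))
  have := wright_extremum (ε := -1) hν0 hν hL hvpos (fun z hz => by
    have : wright (-v) (-ν) 1 ≤ wright (-z) (-ν) 1 := hv (hvpos.le.trans hz)
    linarith)
  rw [hM] at this
  linarith

theorem wright_zero_sub_pos {ν : ℝ} (hν : ν < 1) : 0 < wright 0 (-ν) (1 - ν) := by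
  rw [wright_zero_left]
  have := Real.Gamma_pos_of_pos (sub_pos.2 hν)
  positivity

/-- The slope at 0 is -M(0) < 0, so some value with y > 0 is below 1, and that value is at least L.
-/
theorem lim_wright_one_lt_one {ν L : ℝ} (hν0 : 0 < ν) (hν : ν < 1 / 2)
    (hL : Tendsto (fun y => wright (-y) (-ν) 1) atTop (𝓝 L)) : L < 1 := by
  have hd := hasDerivAt_wright_neg hν0.le hν.le (b := 1) (by linarith) 0
  rw [neg_zero] at hd
  have h2 := (hd.hasDerivWithinAt (s := Ioi 0)).limsup_slope_le' (r := 0) self_notMem_Ioi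
    (by linarith [wright_zero_sub_pos (ν := ν) (by linarith)])
  obtain ⟨y, hy, hy0⟩ := (h2.and self_mem_nhdsWithin).exists
  have hy0' : 0 < y := hy0
  rw [slope_def_field] at hy
  simp only [neg_zero, wright_zero_left, Real.Gamma_one, sub_zero] at hy
  rw [div_lt_iff₀ hy0'] at hy
  have hy1 : wright (-y) (-ν) 1 < 1 := by linarith
  exact (le_wright_one hν0 hν hL hy0'.le hy1).trans_lt hy1

theorem le_wright_one_of_lim {ν L : ℝ} (hν0 : 0 < ν) (hν : ν < 1 / 2)
    (hL : Tendsto (fun y => wright (-y) (-ν) 1) atTop (𝓝 L)) {y : ℝ} (hy : 0 ≤ y) :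
    L ≤ wright (-y) (-ν) 1 := by
  rcases lt_or_ge (wright (-y) (-ν) 1) 1 with h | h
  · exact le_wright_one hν0 hν hL hy h
  · exact (lim_wright_one_lt_one hν0 hν hL).le.trans h

/-- A value above L yields a maximum on [x, ∞). Were it interior, M would vanish there and the
extremum principle with ε = 1 would put the maximum at or below L; so it sits at x. -/
theorem wright_one_le_of_lim_lt {ν L : ℝ} (hν0 : 0 < ν) (hν : ν < 1 / 2)
    (hL : Tendsto (fun y => wright (-y) (-ν) 1) atTop (𝓝 L)) {x y : ℝ} (hx : 0 ≤ x) (hxy : x ≤ y)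
    (hxL : L < wright (-y) (-ν) 1) : wright (-y) (-ν) 1 ≤ wright (-x) (-ν) 1 := by
  have hcont : Continuous fun y => wright (-y) (-ν) 1 :=
    (continuous_wright hν0.le hν.le (by linarith)).comp continuous_neg
  obtain ⟨v, hv0, hv⟩ := exists_isMinOn_Ici hcont.neg hL.neg hxy (neg_lt_neg hxL)
  have hv' : ∀ z, x ≤ z → wright (-z) (-ν) 1 ≤ wright (-v) (-ν) 1 := fun z hz =>
    neg_le_neg_iff.1 (hv hz)
  rcases eq_or_lt_of_le (show x ≤ v from hv0) with rfl | hlt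
  · exact hv' y hxy
  exfalso
  have hloc : IsLocalMax (fun y => wright (-y) (-ν) 1) v := by
    filter_upwards [Ici_mem_nhds hlt] with z hz using hv' z hz
  have hM := wright_sub_eq_zero_of_isLocalExtr hν0 hν (Or.inr hloc)
  have := wright_extremum (ε := 1) hν0 hν hL (hx.trans_lt hlt) (fun z hz => by
    have := hv' z (hlt.le.trans hz)
    linarith)
  rw [hM] at this
  linarith [hv' y hxy]

theorem analyticOnNhd_wright {ν b : ℝ} (hν0 : 0 ≤ ν) (hν : ν ≤ 1 / 2) (hb : b < 1) :
    AnalyticOnNhd ℝ (fun z => wright z (-ν) b) univ := by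
  let c : ℕ → ℝ := fun n => 1 / ((n.factorial : ℝ) * Real.Gamma (-ν * n + b))
  let p := FormalMultilinearSeries.ofScalars ℝ c
  have hr : p.radius = ⊤ := by
    refine p.radius_eq_top_of_summable_norm fun r => ?_
    refine (summable_wright hν0 hν hb r).congr fun n => ?_
    rw [FormalMultilinearSeries.ofScalars_norm, abs_div, abs_pow, abs_of_nonneg r.coe_nonneg,
      Real.norm_eq_abs, abs_div, abs_one, one_div_mul_eq_div]
  have h := p.hasFPowerSeriesOnBall (by rw [hr]; exact ENNReal.zero_lt_top)
  have hp : p.sum = fun z => wright z (-ν) b := by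
    funext z
    have := FormalMultilinearSeries.ofScalars_sum_eq c z
    rw [FormalMultilinearSeries.ofScalarsSum] at this
    rw [this, wright]
    refine tsum_congr fun n => ?_
    rw [smul_eq_mul, one_div_mul_eq_div]
  rw [← hp]
  intro z _
  refine h.analyticAt_of_mem ?_
  rw [hr, Metric.eball_top]
  exact mem_univ z

/-- Reaching L at y would force the constant value L on [y, ∞), since any later value above L is at
most the value at y. Then M vanishes beyond y, hence everywhere by analyticity, contrary to M(0) >
0. -/
theorem lim_lt_wright_one {ν L : ℝ} (hν0 : 0 < ν) (hν : ν < 1 / 2)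
    (hL : Tendsto (fun y => wright (-y) (-ν) 1) atTop (𝓝 L)) {y : ℝ} (hy : 0 ≤ y) :
    L < wright (-y) (-ν) 1 := by
  refine lt_of_le_of_ne (le_wright_one_of_lim hν0 hν hL hy) fun heq => ?_
  have hconst : ∀ v, y ≤ v → wright (-v) (-ν) 1 = L := by
    intro v hv
    refine le_antisymm ?_ (le_wright_one_of_lim hν0 hν hL (hy.trans hv))
    by_contra! hlt
    have := wright_one_le_of_lim_lt hν0 hν hL hy hv hlt
    linarith
  have hzero : ∀ v, y < v → wright (-v) (-ν) (1 - ν) = 0 := by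
    intro v hv
    refine wright_sub_eq_zero_of_isLocalExtr hν0 hν (Or.inr ?_)
    filter_upwards [Ioi_mem_nhds hv] with z hz
    rw [hconst z (le_of_lt hz), hconst v hv.le]
  have h := (analyticOnNhd_wright hν0.le hν.le (b := 1 - ν) (by linarith)).eq_of_eventuallyEq
    (g := fun _ => 0) analyticOnNhd_const (z₀ := -(y + 1)) (by
      filter_upwards [Iio_mem_nhds (show -(y + 1) < -y by linarith)] with z hz
      have := hzero (-z) (by linarith [show z < -y from hz])
      simpa using this)
  have h0 : wright 0 (-ν) (1 - ν) = 0 := congrFun h 0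
  have := wright_zero_sub_pos (ν := ν) (by linarith)
  linarith

/-- Positivity of the Mainardi function. -/
theorem mainardi_pos {ν y : ℝ} (hν0 : 0 < ν) (hν : ν < 1 / 2) (hy : 0 ≤ y) : 0 < mainardi ν y := by
  obtain ⟨L, hL⟩ := exists_tendsto_wright_one hν0 hν
  rw [mainardi]
  rcases eq_or_lt_of_le hy with rfl | hy
  · rw [neg_zero]
    exact wright_zero_sub_pos (by linarith)
  -- All values exceed L, so monotonicity makes every y > 0 a maximum over [y, ∞), and the principle
  -- bounds Γ(1 - ν) M(y) below by the excess over L.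
  have h1 := wright_extremum (ε := 1) hν0 hν hL hy (fun z hz => by
    have := wright_one_le_of_lim_lt hν0 hν hL hy.le hz (lim_lt_wright_one hν0 hν hL (hy.le.trans hz))
    linarith)
  have h2 := lim_lt_wright_one hν0 hν hL hy.le
  have h3 : 0 < Real.Gamma (1 - ν) := Real.Gamma_pos_of_pos (by linarith)
  have h4 : 0 < Real.Gamma (1 - ν) * wright (-y) (-ν) (1 - ν) := by linarith
  exact pos_of_mul_pos_right h4 h3.le

theorem hasDerivAt_wright_one {ν : ℝ} (hν0 : 0 < ν) (hν : ν ≤ 1 / 2) (y : ℝ) :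
    HasDerivAt (fun y => wright (-y) (-ν) 1) (-mainardi ν y) y :=
  hasDerivAt_wright_neg hν0.le hν (by linarith) y

theorem strictAntiOn_wright_one {ν : ℝ} (hν0 : 0 < ν) (hν : ν < 1 / 2) :
    StrictAntiOn (fun y => wright (-y) (-ν) 1) (Ici 0) := by
  have hd := fun y => hasDerivAt_wright_one hν0 hν.le y
  refine strictAntiOn_of_deriv_neg (convex_Ici 0)
    (fun y _ => (hd y).continuousAt.continuousWithinAt) fun y hy => ?_
  rw [interior_Ici] at hy
  rw [(hd y).deriv]
  linarith [mainardi_pos hν0 hν (le_of_lt hy)]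

theorem wright_zero_nonneg {ν y : ℝ} (hν0 : 0 < ν) (hν : ν < 1 / 2) (hy : 0 ≤ y) :
    0 ≤ wright (-y) (-ν) 0 := by
  rw [wright_zero_right hν0 hν.le, neg_mul_neg]
  have : 0 < wright (-y) (-ν) (1 - ν) := mainardi_pos hν0 hν hy
  positivity

/-- The derivative is -W(-y, -ν, 1 - 2ν). With γ = 1 - 2ν > 0, the fractional integral expresses
Γ(γ) W(-y, -ν, γ) as the integral of a nonnegative function. -/
theorem antitoneOn_mainardi {ν : ℝ} (hν0 : 0 < ν) (hν : ν < 1 / 2) :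
    AntitoneOn (mainardi ν) (Ici 0) := by
  have hd : ∀ y, HasDerivAt (mainardi ν) (-wright (-y) (-ν) (1 - ν - ν)) y := fun y =>
    hasDerivAt_wright_neg hν0.le hν.le (by linarith) y
  refine antitoneOn_of_deriv_nonpos (convex_Ici 0)
    (fun y _ => (hd y).continuousAt.continuousWithinAt)
    (fun y _ => (hd y).differentiableAt.differentiableWithinAt) fun y hy => ?_
  rw [interior_Ici] at hy
  have hy0 : 0 < y := hy
  rw [(hd y).deriv]
  have h1 := fractional_integral_wright hν0 hν (γ := 1 - ν - ν) (by linarith) (by linarith) hy0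
  have h2 : 0 ≤ Real.Gamma (1 - ν - ν) * wright (-y) (-ν) (1 - ν - ν) := by
    rw [← h1]
    refine setIntegral_nonneg measurableSet_Ioo fun τ hτ => ?_
    have hτ0 := hτ.1
    have h3 : 0 < 1 - τ := sub_pos.2 hτ.2
    have := wright_zero_nonneg hν0 hν (show 0 ≤ y * τ ^ (-ν) by positivity)
    positivity
  have h3 : 0 < Real.Gamma (1 - ν - ν) := Real.Gamma_pos_of_pos (by linarith)
  linarith [nonneg_of_mul_nonneg_right h2 h3]

end FractionalStefan

/-! ### Monotonicity, limits and range of K. -/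

namespace FractionalStefan

theorem continuous_mainardi {ν : ℝ} (hν0 : 0 < ν) (hν : ν < 1 / 2) : Continuous (mainardi ν) :=
  (continuous_wright hν0.le hν.le (by linarith)).comp continuous_neg

theorem continuous_wright_one_neg {ν : ℝ} (hν0 : 0 < ν) (hν : ν < 1 / 2) :
    Continuous fun y => wright (-y) (-ν) 1 :=
  (continuous_wright hν0.le hν.le (by linarith)).comp continuous_neg

theorem wright_one_le_one {ν y : ℝ} (hν0 : 0 < ν) (hν : ν < 1 / 2) (hy : 0 ≤ y) :
    wright (-y) (-ν) 1 ≤ 1 := by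
  have h : wright (-y) (-ν) 1 ≤ wright (-0) (-ν) 1 :=
    (strictAntiOn_wright_one hν0 hν).antitoneOn self_mem_Ici hy hy
  rwa [neg_zero, wright_zero_left, Real.Gamma_one, div_one] at h

section K

variable {α lam h m : ℝ}

theorem convection_const_pos (hα1 : α < 1) (hlam : 0 < lam) (hh : 0 < h) (hm : 0 < m) :
    0 < m / (h * lam * Real.Gamma (1 - α / 2)) := by
  have : 0 < Real.Gamma (1 - α / 2) := Real.Gamma_pos_of_pos (by linarith)
  positivity

theorem continuousOn_K (hα0 : 0 < α) (hα1 : α < 1) : ContinuousOn (K α lam h m) (Ici 0) := by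
  have h1 := continuous_mainardi (ν := α / 2) (by linarith) (by linarith)
  have h2 := continuous_wright_one_neg (ν := α / 2) (by linarith) (by linarith)
  refine ContinuousOn.mul (by fun_prop) ?_
  refine continuousOn_const.div h1.continuousOn fun y hy => ?_
  exact (mainardi_pos (by linarith) (by linarith) hy).ne'

/-- Both η and the bracket increase strictly and are positive, while 1/M is nondecreasing and
positive. -/
theorem strictMonoOn_K (hα0 : 0 < α) (hα1 : α < 1) (hlam : 0 < lam) (hh : 0 < h) (hm : 0 < m) :
    StrictMonoOn (K α lam h m) (Ioi 0) := by
  intro x hx y hy hxy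
  have hx0 : 0 < x := hx
  have hy0 : 0 < y := hy
  have hc := convection_const_pos hα1 hlam hh hm
  have hE := (strictAntiOn_wright_one (ν := α / 2) (by linarith) (by linarith)) hx0.le hy0.le hxy
  have hE1 := wright_one_le_one (ν := α / 2) (by linarith) (by linarith) hx0.le
  have hM := antitoneOn_mainardi (ν := α / 2) (by linarith) (by linarith) hx0.le hy0.le hxy.le
  have hMy := mainardi_pos (ν := α / 2) (by linarith) (by linarith) hy0.le
  have hMx := mainardi_pos (ν := α / 2) (by linarith) (by linarith) hx0.le
  simp only at hE
  rw [K, K]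
  have h1 : x * (1 - wright (-x) (-(α / 2)) 1 + m / (h * lam * Real.Gamma (1 - α / 2))) <
      y * (1 - wright (-y) (-(α / 2)) 1 + m / (h * lam * Real.Gamma (1 - α / 2))) :=
    mul_lt_mul hxy (by linarith) (by linarith) hy0.le
  have h2 : 1 / mainardi (α / 2) x ≤ 1 / mainardi (α / 2) y := one_div_le_one_div_of_le hMy hM
  exact mul_lt_mul h1 h2 (by positivity) (mul_nonneg hy0.le (by linarith))

theorem K_zero : K α lam h m 0 = 0 := by simp [K]

theorem tendsto_K_zero (hα0 : 0 < α) (hα1 : α < 1) : Tendsto (K α lam h m) (𝓝[>] 0) (𝓝 0) := by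
  have := (continuousOn_K (lam := lam) (h := h) (m := m) hα0 hα1 0 self_mem_Ici).mono_left
    (nhdsWithin_mono 0 Ioi_subset_Ici_self)
  rwa [K_zero] at this

/-- The bracket is at least the convective constant c > 0 and 1/M(η) ≥ 1/M(0), so K(η) ≥ c η / M(0).
-/
theorem tendsto_K_atTop (hα0 : 0 < α) (hα1 : α < 1) (hlam : 0 < lam) (hh : 0 < h) (hm : 0 < m) :
    Tendsto (K α lam h m) atTop atTop := by
  have hc := convection_const_pos hα1 hlam hh hm
  set c := m / (h * lam * Real.Gamma (1 - α / 2))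
  have hM0 := mainardi_pos (ν := α / 2) (by linarith) (by linarith) le_rfl
  refine tendsto_atTop_mono' _ ?_
    (tendsto_id.const_mul_atTop (show 0 < c * (1 / mainardi (α / 2) 0) by positivity))
  filter_upwards [eventually_ge_atTop 0] with y hy
  have hE1 := wright_one_le_one (ν := α / 2) (by linarith) (by linarith) hy
  have hM := antitoneOn_mainardi (ν := α / 2) (by linarith) (by linarith) self_mem_Ici hy hy
  have hMy := mainardi_pos (ν := α / 2) (by linarith) (by linarith) hy
  have h2 : 1 / mainardi (α / 2) 0 ≤ 1 / mainardi (α / 2) y := one_div_le_one_div_of_le hMy hM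
  rw [K, id, mul_comm, ← mul_assoc]
  gcongr
  linarith

theorem exists_K_eq (hα0 : 0 < α) (hα1 : α < 1) (hlam : 0 < lam) (hh : 0 < h) (hm : 0 < m)
    {v : ℝ} (hv : 0 < v) : ∃ η, 0 < η ∧ K α lam h m η = v := by
  obtain ⟨R, hR, hR0⟩ := ((tendsto_K_atTop hα0 hα1 hlam hh hm).eventually_ge_atTop v |>.and
    (eventually_gt_atTop 0)).exists
  obtain ⟨η, hη, hηv⟩ := intermediate_value_Icc hR0.le
    ((continuousOn_K (lam := lam) (h := h) (m := m) hα0 hα1).mono Icc_subset_Ici_self)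
    (show v ∈ Icc _ _ from ⟨by rw [K_zero]; exact hv.le, hR⟩)
  refine ⟨η, lt_of_le_of_ne hη.1 ?_, hηv⟩
  rintro rfl
  rw [K_zero] at hηv
  exact hv.ne hηv

end K

/-! ### Caputo derivatives of the front and of the similarity profile. -/

section Caputo

/-- The substitution `τ = t σ` in the Caputo integral of a homogeneous function. -/
theorem caputo_integral_scaling {α t κ : ℝ} (ht : 0 < t) {F G : ℝ → ℝ}
    (hFG : ∀ σ ∈ Ioo (0 : ℝ) 1, F (t * σ) = κ * G σ)
    (hG : IntegrableOn (fun σ => (1 - σ) ^ (-α) * G σ) (Ioo 0 1)) :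
    IntervalIntegrable (fun τ => (t - τ) ^ (-α) * F τ) volume 0 t ∧
      ∫ τ in (0 : ℝ)..t, (t - τ) ^ (-α) * F τ =
        t ^ (1 - α) * κ * ∫ σ in Ioo (0 : ℝ) 1, (1 - σ) ^ (-α) * G σ := by
  have hpt : ∀ σ ∈ Ioo (0 : ℝ) 1, (t - t * σ) ^ (-α) * F (t * σ) =
      t ^ (-α) * κ * ((1 - σ) ^ (-α) * G σ) := by
    intro σ hσ
    rw [hFG σ hσ, ← mul_one_sub, Real.mul_rpow ht.le (sub_pos.2 hσ.2).le]
    ring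
  constructor
  · have h1 : IntervalIntegrable (fun σ => (t - t * σ) ^ (-α) * F (t * σ)) volume 0 1 := by
      rw [intervalIntegrable_iff_integrableOn_Ioo_of_le zero_le_one]
      exact IntegrableOn.congr_fun (hG.const_mul (t ^ (-α) * κ)) (fun σ hσ => (hpt σ hσ).symm)
        measurableSet_Ioo
    have h3 := h1.comp_mul_left (c := t⁻¹)
    simp only [div_inv_eq_mul, one_mul, zero_mul] at h3
    refine h3.congr ?_
    intro τ _
    simp only
    rw [mul_inv_cancel_left₀ ht.ne']
  · have h := intervalIntegral.smul_integral_comp_mul_left (a := 0) (b := 1)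
      (fun τ => (t - τ) ^ (-α) * F τ) t
    rw [mul_zero, mul_one] at h
    rw [← h, intervalIntegral.integral_of_le zero_le_one, integral_Ioc_eq_integral_Ioo,
      setIntegral_congr_fun measurableSet_Ioo hpt, integral_const_mul, smul_eq_mul,
      sub_eq_add_neg 1 α, Real.rpow_add ht, Real.rpow_one]
    ring

theorem integral_beta {u v : ℝ} (hu : 0 < u) (hv : 0 < v) :
    ∫ τ in Ioo (0 : ℝ) 1, τ ^ (u - 1) * (1 - τ) ^ (v - 1) =
      Real.Gamma u * Real.Gamma v / Real.Gamma (u + v) := by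
  have h := Complex.betaIntegral_eq_Gamma_mul_div u v (by simpa) (by simpa)
  rw [Complex.betaIntegral, intervalIntegral.integral_of_le zero_le_one,
    integral_Ioc_eq_integral_Ioo, ← Complex.ofReal_add, Complex.Gamma_ofReal, Complex.Gamma_ofReal,
    Complex.Gamma_ofReal] at h
  apply Complex.ofReal_injective
  rw [← integral_complex_ofReal]
  push_cast
  rw [← h]
  refine setIntegral_congr_fun measurableSet_Ioo fun τ hτ => ?_
  rw [Complex.ofReal_cpow hτ.1.le, Complex.ofReal_cpow (sub_pos.2 hτ.2).le]
  push_cast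
  rfl

theorem caputoDeriv_congr {α t : ℝ} (ht : 0 ≤ t) {f F : ℝ → ℝ}
    (hf : ∀ τ ∈ Ioo 0 t, HasDerivAt f (F τ) τ) :
    caputoDeriv α f t = 1 / Real.Gamma (1 - α) * ∫ τ in (0 : ℝ)..t, (t - τ) ^ (-α) * F τ := by
  rw [caputoDeriv, intervalIntegral.integral_of_le ht, intervalIntegral.integral_of_le ht,
    integral_Ioc_eq_integral_Ioo, integral_Ioc_eq_integral_Ioo]
  congr 1
  refine setIntegral_congr_fun measurableSet_Ioo fun τ hτ => ?_
  rw [(hf τ hτ).deriv]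

theorem caputoDifferentiableAt_of_hasDerivAt {α t : ℝ} (ht : 0 ≤ t) {f F : ℝ → ℝ}
    (hf : ∀ τ ∈ Ioo 0 t, HasDerivAt f (F τ) τ)
    (hF : IntervalIntegrable (fun τ => (t - τ) ^ (-α) * F τ) volume 0 t) :
    CaputoDifferentiableAt α f t := by
  refine ⟨fun τ hτ => (hf τ hτ).differentiableAt, ?_⟩
  rw [intervalIntegrable_iff_integrableOn_Ioo_of_le ht] at hF ⊢
  refine hF.congr_fun (fun τ hτ => ?_) measurableSet_Ioo
  rw [(hf τ hτ).deriv]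

/-- After scaling, the Caputo integral is B(α/2, 1 - α), and the factor α/2 is absorbed by Γ(1 +
α/2) = (α/2) Γ(α/2). -/
theorem caputo_s₃ {α lam η t : ℝ} (hα0 : 0 < α) (hα1 : α < 1) (ht : 0 < t) :
    CaputoDifferentiableAt α (s₃ α lam η) t ∧
    caputoDeriv α (s₃ α lam η) t =
      lam * η * (Real.Gamma (1 + α / 2) / Real.Gamma (1 - α / 2)) * (1 / t ^ (α / 2)) := by
  have hν : 0 < α / 2 := by linarith
  have hd : ∀ τ ∈ Ioo 0 t, HasDerivAt (s₃ α lam η) (lam * η * (α / 2 * τ ^ (α / 2 - 1))) τ :=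
    fun τ hτ => (Real.hasDerivAt_rpow_const (Or.inl hτ.1.ne')).const_mul (lam * η)
  have hint : IntegrableOn (fun σ : ℝ => (1 - σ) ^ (-α) * σ ^ (α / 2 - 1)) (Ioo 0 1) := by
    refine (integrableOn_beta hν (v := 1 - α) (by linarith)).congr_fun (fun σ _ => ?_)
      measurableSet_Ioo
    rw [show 1 - α - 1 = -α by ring, mul_comm]
  have hval : ∫ σ in Ioo (0 : ℝ) 1, (1 - σ) ^ (-α) * σ ^ (α / 2 - 1) =
      Real.Gamma (α / 2) * Real.Gamma (1 - α) / Real.Gamma (1 - α / 2) := by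
    have h := integral_beta hν (v := 1 - α) (by linarith)
    rw [show α / 2 + (1 - α) = 1 - α / 2 by ring] at h
    rw [← h]
    refine setIntegral_congr_fun measurableSet_Ioo fun σ _ => ?_
    rw [show 1 - α - 1 = -α by ring, mul_comm]
  obtain ⟨h1, h2⟩ := caputo_integral_scaling (α := α) (κ := lam * η * (α / 2) * t ^ (α / 2 - 1))
    (F := fun τ => lam * η * (α / 2 * τ ^ (α / 2 - 1))) (G := fun σ => σ ^ (α / 2 - 1)) ht
    (fun σ hσ => by
      rw [Real.mul_rpow ht.le hσ.1.le]
      ring) hint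
  refine ⟨caputoDifferentiableAt_of_hasDerivAt ht.le hd h1, ?_⟩
  have hG1 : Real.Gamma (1 - α) ≠ 0 := (Real.Gamma_pos_of_pos (by linarith)).ne'
  have hG2 : Real.Gamma (1 - α / 2) ≠ 0 := (Real.Gamma_pos_of_pos (by linarith)).ne'
  have hpow : t ^ (1 - α) * t ^ (α / 2 - 1) = 1 / t ^ (α / 2) := by
    rw [← Real.rpow_add ht, one_div, ← Real.rpow_neg ht.le]
    ring_nf
  rw [caputoDeriv_congr ht.le hd, h2, hval, ← hpow, add_comm 1, Real.Gamma_add_one hν.ne']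
  field_simp

theorem div_mul_rpow_eq {x lam ν t : ℝ} (ht : 0 ≤ t) :
    x / (lam * t ^ ν) = x / lam * t ^ (-ν) := by
  rw [Real.rpow_neg ht, ← div_div, div_eq_mul_inv (x / lam)]

/-- Scaling time to 1 reduces this to the fractional integral with ν = α/2 and γ = 1 - α; here γ + ν
= 1 - α/2 ≤ 1. -/
theorem caputo_similarity {α lam a b x t : ℝ} (hα0 : 0 < α) (hα1 : α < 1) (hlam : 0 < lam)
    (hx : 0 < x) (ht : 0 < t) :
    CaputoDifferentiableAt α
      (fun τ => a + b * wright (-(x / (lam * τ ^ (α / 2)))) (-(α / 2)) 1) t ∧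
    caputoDeriv α (fun τ => a + b * wright (-(x / (lam * τ ^ (α / 2)))) (-(α / 2)) 1) t =
      b * (t ^ (-α) * wright (-(x / (lam * t ^ (α / 2)))) (-(α / 2)) (1 - α)) := by
  have hν0 : 0 < α / 2 := by linarith
  have hν : α / 2 < 1 / 2 := by linarith
  have hd : ∀ τ ∈ Ioo 0 t, HasDerivAt
      (fun τ => a + b * wright (-(x / (lam * τ ^ (α / 2)))) (-(α / 2)) 1)
      (b * (τ⁻¹ * wright (-(x / lam * τ ^ (-(α / 2)))) (-(α / 2)) 0)) τ := by
    intro τ hτ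
    refine (((hasDerivAt_wright_similarity hν0 hν.le (x / lam) hτ.1).const_mul b).const_add
      a).congr_of_eventuallyEq ?_
    filter_upwards [Ioi_mem_nhds hτ.1] with σ hσ
    rw [div_mul_rpow_eq (le_of_lt hσ)]
  have hX : 0 < x / lam * t ^ (-(α / 2)) := by positivity
  have hint := integrableOn_rpow_mul_wright hν0 hν (γ := 1 - α) (by linarith) hX
  have hval := fractional_integral_wright hν0 hν (γ := 1 - α) (by linarith) (by linarith) hX
  rw [show 1 - α - 1 = -α by ring] at hint hval
  obtain ⟨h1, h2⟩ := caputo_integral_scaling (α := α) (κ := b * t⁻¹)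
    (F := fun τ => b * (τ⁻¹ * wright (-(x / lam * τ ^ (-(α / 2)))) (-(α / 2)) 0))
    (G := fun σ => σ⁻¹ * wright (-(x / lam * t ^ (-(α / 2)) * σ ^ (-(α / 2)))) (-(α / 2)) 0) ht
    (fun σ hσ => by
      rw [Real.mul_rpow ht.le hσ.1.le, mul_inv, mul_assoc (x / lam)]
      ring) hint
  refine ⟨caputoDifferentiableAt_of_hasDerivAt ht.le hd h1, ?_⟩
  have hG1 : Real.Gamma (1 - α) ≠ 0 := (Real.Gamma_pos_of_pos (by linarith)).ne'
  have hpow : t ^ (1 - α) * t⁻¹ = t ^ (-α) := by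
    rw [← Real.rpow_neg_one, ← Real.rpow_add ht]
    ring_nf
  rw [caputoDeriv_congr ht.le hd, h2, hval, ← hpow, div_mul_rpow_eq ht.le]
  field_simp

end Caputo

/-! ### Space derivatives and the corner of the region. -/

section Space

variable {α lam a b t : ℝ}

theorem hasDerivAt_similarity_space (hα0 : 0 < α) (hα1 : α < 1) (y : ℝ) :
    HasDerivAt (fun y => a + b * wright (-(y / (lam * t ^ (α / 2)))) (-(α / 2)) 1)
      (-(b / (lam * t ^ (α / 2))) * mainardi (α / 2) (y / (lam * t ^ (α / 2)))) y := by
  have h := (((hasDerivAt_wright_one (ν := α / 2) (by linarith) (by linarith)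
    (y / (lam * t ^ (α / 2)))).comp y
      ((hasDerivAt_id y).div_const (lam * t ^ (α / 2)))).const_mul b).const_add a
  convert! h using 1
  ring

/-- Two derivatives lower the parameter from 1 to 1 - 2(α/2) = 1 - α, the parameter produced by the
Caputo derivative; this match is the diffusion equation. -/
theorem spaceDeriv₂_similarity (hα0 : 0 < α) (hα1 : α < 1) (y : ℝ) :
    HasDerivAt (fun z => deriv (fun y =>
      a + b * wright (-(y / (lam * t ^ (α / 2)))) (-(α / 2)) 1) z)
      (b / (lam * t ^ (α / 2)) ^ 2 * wright (-(y / (lam * t ^ (α / 2)))) (-(α / 2)) (1 - α)) y := by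
  have h1 : (fun z => deriv (fun y =>
      a + b * wright (-(y / (lam * t ^ (α / 2)))) (-(α / 2)) 1) z) = fun z =>
      -(b / (lam * t ^ (α / 2))) * mainardi (α / 2) (z / (lam * t ^ (α / 2))) :=
    funext fun z => (hasDerivAt_similarity_space hα0 hα1 z).deriv
  have h2 : HasDerivAt (mainardi (α / 2)) _ (y / (lam * t ^ (α / 2))) :=
    hasDerivAt_wright_neg (ν := α / 2) (b := 1 - α / 2) (by linarith) (by linarith) (by linarith)
      (y / (lam * t ^ (α / 2)))
  have h := (h2.comp y ((hasDerivAt_id y).div_const (lam * t ^ (α / 2)))).const_mul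
    (-(b / (lam * t ^ (α / 2))))
  rw [h1]
  convert! h using 1
  rw [show 1 - α / 2 - α / 2 = 1 - α by ring]
  ring

theorem spaceDeriv_similarity (hα0 : 0 < α) (hα1 : α < 1) {s : ℝ → ℝ} {x : ℝ} (hs : 0 < s t)
    (hx : x ∈ Icc 0 (s t)) :
    spaceDeriv (fun x t => a + b * wright (-(x / (lam * t ^ (α / 2)))) (-(α / 2)) 1) s x t =
      -(b / (lam * t ^ (α / 2))) * mainardi (α / 2) (x / (lam * t ^ (α / 2))) :=
  (hasDerivAt_similarity_space hα0 hα1 x).hasDerivWithinAt.derivWithin (uniqueDiffOn_Icc hs x hx)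

theorem mainardi_zero (ν : ℝ) : mainardi ν 0 = 1 / Real.Gamma (1 - ν) := by
  rw [mainardi, neg_zero, wright_zero_left]

theorem continuousOn_similarity_variable {ν : ℝ} (hlam : 0 < lam) :
    ContinuousOn (fun p : ℝ × ℝ => p.1 / (lam * p.2 ^ ν)) {p | 0 < p.2} := by
  have h : ContinuousOn (fun p : ℝ × ℝ => p.2 ^ ν) {p | 0 < p.2} :=
    continuousOn_snd.rpow_const fun p hp => Or.inl (ne_of_gt hp)
  refine continuousOn_fst.div (continuousOn_const.mul h) fun p hp => ?_
  have hp' : 0 < p.2 := hp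
  positivity

/-- The points (s(t)/2, t) approach the corner. Nontriviality of the filter is what makes liminf ≤
limsup there. -/
theorem neBot_nhdsWithin_openRegion {s : ℝ → ℝ} (hs : ∀ t, 0 < t → 0 < s t) (hs0 : s 0 = 0)
    (hsc : ContinuousOn s (Ici 0)) : (𝓝[openRegion s] ((0, 0) : ℝ × ℝ)).NeBot := by
  rw [← mem_closure_iff_nhdsWithin_neBot]
  have h1 : Tendsto s (𝓝[>] 0) (𝓝 0) := by
    have := (hsc 0 self_mem_Ici).mono_left (nhdsWithin_mono 0 Ioi_subset_Ici_self)
    rwa [hs0] at this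
  have h2 : Tendsto (fun t => s t / 2) (𝓝[>] 0) (𝓝 0) := by simpa using h1.div_const 2
  refine mem_closure_of_tendsto (h2.prodMk_nhds (tendsto_id.mono_left nhdsWithin_le_nhds)) ?_
  filter_upwards [self_mem_nhdsWithin] with t ht
  have := hs t ht
  exact ⟨ht, by positivity, half_lt_self this⟩

end Space

/-! ### Existence and uniqueness of the similarity solution. -/

/-- A similarity profile whose coefficients match the boundary conditions solves the problem. -/
theorem isSolution_similarity {α lam k h m C D a b η : ℝ} (hα0 : 0 < α) (hα1 : α < 1)
    (hlam : 0 < lam) (hh : 0 < h) (hη : 0 < η) (hb : 0 ≤ b)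
    (hconv : a + b = D - b * (m / (h * lam * Real.Gamma (1 - α / 2))))
    (hfront : a + b * wright (-η) (-(α / 2)) 1 = C)
    (hstefan : lam * η * (Real.Gamma (1 + α / 2) / Real.Gamma (1 - α / 2)) =
      k * (b / lam * mainardi (α / 2) η)) :
    IsSolution α lam k h m C D
      (fun x t => a + b * wright (-(x / (lam * t ^ (α / 2)))) (-(α / 2)) 1) (s₃ α lam η) := by
  have hν0 : 0 < α / 2 := by linarith
  have hν : α / 2 < 1 / 2 := by linarith
  have hG : 0 < Real.Gamma (1 - α / 2) := Real.Gamma_pos_of_pos (by linarith)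
  have hs : ∀ t, 0 < t → 0 < s₃ α lam η t := fun t ht => by
    rw [s₃]
    positivity
  have hs0 : s₃ α lam η 0 = 0 := by rw [s₃, Real.zero_rpow hν0.ne', mul_zero]
  have hsc : Continuous (s₃ α lam η) :=
    continuous_const.mul (Real.continuous_rpow_const hν0.le)
  have hse : ∀ t, 0 < t → s₃ α lam η t / (lam * t ^ (α / 2)) = η := fun t ht => by
    have : 0 < t ^ (α / 2) := by positivity
    rw [s₃]
    field_simp
  have hsd : ∀ t, 0 < t → HasDerivAt (s₃ α lam η) (lam * η * (α / 2 * t ^ (α / 2 - 1))) t :=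
    fun t ht => (Real.hasDerivAt_rpow_const (Or.inl ht.ne')).const_mul (lam * η)
  have hvar := continuousOn_similarity_variable (ν := α / 2) hlam
  have hopen : openRegion (s₃ α lam η) ⊆ {p | 0 < p.2} := fun p hp => hp.1
  have hclosed : closedRegion (s₃ α lam η) ⊆ {p | 0 < p.2} := fun p hp => hp.1
  have hxxc : ContinuousOn (fun p : ℝ × ℝ => b / (lam * p.2 ^ (α / 2)) ^ 2 *
      wright (-(p.1 / (lam * p.2 ^ (α / 2)))) (-(α / 2)) (1 - α)) (openRegion (s₃ α lam η)) := by
    have hw := continuous_wright (ν := α / 2) (b := 1 - α) hν0.le hν.le (by linarith)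
    have hp2 : ContinuousOn (fun p : ℝ × ℝ => p.2 ^ (α / 2)) (openRegion (s₃ α lam η)) :=
      continuousOn_snd.rpow_const fun p hp => Or.inl (ne_of_gt hp.1)
    refine ContinuousOn.mul (continuousOn_const.div ((continuousOn_const.mul hp2).pow 2) ?_)
      (hw.comp_continuousOn (hvar.mono hopen).neg)
    intro p hp
    have : 0 < p.2 := hp.1
    positivity
  have hdiff : ∀ x t, 0 < t → 0 < x → x < s₃ α lam η t →
      caputoDeriv α (fun τ => a + b * wright (-(x / (lam * τ ^ (α / 2)))) (-(α / 2)) 1) t =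
      lam ^ 2 * spaceDeriv₂
        (fun x t => a + b * wright (-(x / (lam * t ^ (α / 2)))) (-(α / 2)) 1) x t := by
    intro x t ht hx _
    rw [(caputo_similarity hα0 hα1 hlam hx ht).2, spaceDeriv₂,
      (spaceDeriv₂_similarity hα0 hα1 x).deriv, Real.rpow_neg ht.le]
    have h1 : t ^ α = t ^ (α / 2) * t ^ (α / 2) := by
      rw [← Real.rpow_add ht]
      ring_nf
    have h2 : 0 < t ^ (α / 2) := by positivity
    rw [h1]
    field_simp
  -- Inside the region the similarity variable lies in [0, η]. As b ≥ 0 and the profile decreases, u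
  -- stays between its front value C and its value a + b at x = 0, which settles all corner
  -- conditions.
  have hbound : ∀ p ∈ openRegion (s₃ α lam η),
      C ≤ a + b * wright (-(p.1 / (lam * p.2 ^ (α / 2)))) (-(α / 2)) 1 ∧
      a + b * wright (-(p.1 / (lam * p.2 ^ (α / 2)))) (-(α / 2)) 1 ≤ a + b := by
    rintro p ⟨hp2, hp1, hps⟩
    have h2 : 0 < lam * p.2 ^ (α / 2) := by positivity
    have h0 : 0 ≤ p.1 / (lam * p.2 ^ (α / 2)) := by positivity
    have hle : p.1 / (lam * p.2 ^ (α / 2)) ≤ η := by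
      rw [← hse p.2 hp2]
      gcongr
    have h3 : wright (-η) (-(α / 2)) 1 ≤ wright (-(p.1 / (lam * p.2 ^ (α / 2)))) (-(α / 2)) 1 :=
      (strictAntiOn_wright_one hν0 hν).antitoneOn h0 hη.le hle
    have h4 := wright_one_le_one hν0 hν h0
    rw [← hfront]
    constructor
    · gcongr
    · linarith [mul_le_of_le_one_right hb h4]
  have hlow : (C : EReal) ≤ liminf (fun p : ℝ × ℝ =>
      ((a + b * wright (-(p.1 / (lam * p.2 ^ (α / 2)))) (-(α / 2)) 1 : ℝ) : EReal))
      (𝓝[openRegion (s₃ α lam η)] (0, 0)) := by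
    refine le_liminf_of_le (by isBoundedDefault) ?_
    filter_upwards [self_mem_nhdsWithin] with p hp
    exact EReal.coe_le_coe_iff.2 (hbound p hp).1
  have hup : limsup (fun p : ℝ × ℝ =>
      ((a + b * wright (-(p.1 / (lam * p.2 ^ (α / 2)))) (-(α / 2)) 1 : ℝ) : EReal))
      (𝓝[openRegion (s₃ α lam η)] (0, 0)) ≤ ((a + b : ℝ) : EReal) := by
    refine limsup_le_of_le (by isBoundedDefault) ?_
    filter_upwards [self_mem_nhdsWithin] with p hp
    exact EReal.coe_le_coe_iff.2 (hbound p hp).2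
  have hne := neBot_nhdsWithin_openRegion hs hs0 hsc.continuousOn
  constructor
  · exact hs
  · exact hdiff
  · intro t ht
    have h1 : 0 < t ^ (α / 2) := by positivity
    have h2 : a + b - D = -(b * (m / (h * lam * Real.Gamma (1 - α / 2)))) := by linarith
    rw [spaceDeriv_similarity hα0 hα1 (hs t ht) (left_mem_Icc.2 (hs t ht).le), zero_div, neg_zero,
      wright_zero_left, Real.Gamma_one, mainardi_zero, div_one, mul_one, h2]
    field_simp
  · intro t ht
    rw [hse t ht, hfront]
  · intro t ht
    rw [(caputo_s₃ hα0 hα1 ht).2,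
      spaceDeriv_similarity hα0 hα1 (hs t ht) (right_mem_Icc.2 (hs t ht).le), hse t ht, hstefan]
    ring
  · exact hs0
  · exact fun x t ht hx _ => (caputo_similarity hα0 hα1 hlam hx ht).1
  · refine ((continuousOn_const (c := lam ^ 2)).mul hxxc).congr fun p hp => ?_
    rw [hdiff p.1 p.2 hp.1 hp.2.1 hp.2.2, spaceDeriv₂, (spaceDeriv₂_similarity hα0 hα1 p.1).deriv]
    rfl
  · exact fun x t _ _ _ => (spaceDeriv₂_similarity hα0 hα1 x).differentiableAt
  · exact hxxc.congr fun p _ => (spaceDeriv₂_similarity hα0 hα1 p.1).deriv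
  · refine continuousOn_const.add (continuousOn_const.mul ?_)
    exact (continuous_wright_one_neg hν0 hν).comp_continuousOn (hvar.mono hclosed)
  · exact fun x t _ _ _ =>
      (hasDerivAt_similarity_space hα0 hα1 x).differentiableAt.differentiableWithinAt
  · have hc : ContinuousOn (fun p : ℝ × ℝ => -(b / (lam * p.2 ^ (α / 2))) *
        mainardi (α / 2) (p.1 / (lam * p.2 ^ (α / 2)))) (closedRegion (s₃ α lam η)) := by
      have hp2 : ContinuousOn (fun p : ℝ × ℝ => p.2 ^ (α / 2)) (closedRegion (s₃ α lam η)) :=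
        continuousOn_snd.rpow_const fun p hp => Or.inl (ne_of_gt hp.1)
      refine ContinuousOn.mul (continuousOn_const.div (continuousOn_const.mul hp2) ?_).neg
        ((continuous_mainardi hν0 hν).comp_continuousOn (hvar.mono hclosed))
      intro p hp
      have : 0 < p.2 := hp.1
      have : 0 < lam * p.2 ^ (α / 2) := by positivity
      exact this.ne'
    exact hc.congr fun p hp => spaceDeriv_similarity hα0 hα1 (hs p.2 hp.1) hp.2
  · exact (EReal.bot_lt_coe C).trans_le hlow
  · exact fun hC => (EReal.coe_nonneg.2 hC).trans hlow
  · exact liminf_le_limsup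
  · exact hup.trans_lt (EReal.coe_lt_top _)
  · exact hsc.continuousOn
  · exact fun t ht => (hsd t ht).differentiableAt
  · have hc : ContinuousOn (fun t : ℝ => lam * η * (α / 2 * t ^ (α / 2 - 1))) (Ioi 0) :=
      continuousOn_const.mul (continuousOn_const.mul
        (continuousOn_id.rpow_const fun t ht => Or.inl (ne_of_gt ht)))
    exact hc.congr fun t ht => (hsd t ht).deriv
  · exact fun t ht => (caputo_s₃ hα0 hα1 ht).1

/-- The Stefan condition is the equation for `K`. -/
theorem stefan_iff_K {α lam k h m C D η b : ℝ} (hα0 : 0 < α) (hα1 : α < 1) (hlam : 0 < lam)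
    (hh : 0 < h) (hm : 0 < m) (hη : 0 < η)
    (hb : b * (1 - wright (-η) (-(α / 2)) 1 + m / (h * lam * Real.Gamma (1 - α / 2))) = D - C) :
    lam * η * (Real.Gamma (1 + α / 2) / Real.Gamma (1 - α / 2)) =
      k * (b / lam * mainardi (α / 2) η) ↔
    K α lam h m η = k / lam ^ 2 * (Real.Gamma (1 - α / 2) / Real.Gamma (1 + α / 2)) * (D - C) := by
  have hM := mainardi_pos (ν := α / 2) (by linarith) (by linarith) hη.le
  have hE := wright_one_le_one (ν := α / 2) (by linarith) (by linarith) hη.le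
  have hc := convection_const_pos hα1 hlam hh hm
  have hG1 : 0 < Real.Gamma (1 - α / 2) := Real.Gamma_pos_of_pos (by linarith)
  have hG2 : 0 < Real.Gamma (1 + α / 2) := Real.Gamma_pos_of_pos (by linarith)
  rw [K, ← hb]
  set q := 1 - wright (-η) (-(α / 2)) 1 + m / (h * lam * Real.Gamma (1 - α / 2))
  have hq : 0 < q := by linarith
  clear_value q
  generalize Real.Gamma (1 - α / 2) = G₁ at *
  generalize Real.Gamma (1 + α / 2) = G₂ at *
  constructor
  · intro e
    field_simp at e ⊢
    linear_combination e
  · intro e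
    field_simp at e ⊢
    linear_combination e

/-- Time 1 determines the constants: with η = s(1)/λ, the convective and front conditions subtract
to b times the bracket of K equals D - C, so b ≠ 0. The front condition at other times and
injectivity of the profile then force s(t) = λ η t^(α/2), and the Stefan condition at time 1 is the
equation for K. -/
theorem similarity_solution_unique {α lam k h m C D a b : ℝ} {s : ℝ → ℝ} (hα0 : 0 < α)
    (hα1 : α < 1) (hlam : 0 < lam) (hh : 0 < h) (hm : 0 < m) (hCD : C < D)
    (hsol : IsSolution α lam k h m C D
      (fun x t => a + b * wright (-(x / (lam * t ^ (α / 2)))) (-(α / 2)) 1) s) :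
    ∃ η, 0 < η ∧ K α lam h m η =
        k / lam ^ 2 * (Real.Gamma (1 - α / 2) / Real.Gamma (1 + α / 2)) * (D - C) ∧
      (∀ x t : ℝ, a + b * wright (-(x / (lam * t ^ (α / 2)))) (-(α / 2)) 1 =
        u₃ α lam h m C D η x t) ∧ ∀ t, 0 ≤ t → s t = s₃ α lam η t := by
  have hν0 : 0 < α / 2 := by linarith
  have hν : α / 2 < 1 / 2 := by linarith
  have hG : 0 < Real.Gamma (1 - α / 2) := Real.Gamma_pos_of_pos (by linarith)
  have hc := convection_const_pos hα1 hlam hh hm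
  set c := m / (h * lam * Real.Gamma (1 - α / 2)) with hcdef
  have hs1 := hsol.s_pos 1 one_pos
  set η := s 1 / lam with hηdef
  have hη : 0 < η := by positivity
  have hab : a + b = D - b * c := by
    have h1 := hsol.convective 1 one_pos
    rw [spaceDeriv_similarity hα0 hα1 hs1 (left_mem_Icc.2 hs1.le), zero_div, neg_zero,
      wright_zero_left, Real.Gamma_one, mainardi_zero, Real.one_rpow, mul_one, div_one, div_one, mul_one] at h1
    rw [hcdef]
    clear_value c
    generalize Real.Gamma (1 - α / 2) = G₁ at *
    field_simp at h1 ⊢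
    linarith
  have hfront : ∀ t, 0 < t → a + b * wright (-(s t / (lam * t ^ (α / 2)))) (-(α / 2)) 1 = C :=
    hsol.front_temp
  have hη1 := hfront 1 one_pos
  rw [Real.one_rpow, mul_one, ← hηdef] at hη1
  have hE := wright_one_le_one hν0 hν hη.le
  have hq : 0 < 1 - wright (-η) (-(α / 2)) 1 + c := by linarith
  have hbq : b * (1 - wright (-η) (-(α / 2)) 1 + c) = D - C := by linarith
  have hb : b ≠ 0 := by
    rintro rfl
    linarith
  have hs : ∀ t, 0 ≤ t → s t = s₃ α lam η t := by
    intro t ht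
    rcases eq_or_lt_of_le ht with rfl | ht
    · rw [hsol.s_zero, s₃, Real.zero_rpow hν0.ne', mul_zero]
    have hst := hsol.s_pos t ht
    have hpow : 0 < t ^ (α / 2) := by positivity
    have h1 : wright (-(s t / (lam * t ^ (α / 2)))) (-(α / 2)) 1 = wright (-η) (-(α / 2)) 1 :=
      mul_left_cancel₀ hb (by linarith [hfront t ht])
    have h2 : s t / (lam * t ^ (α / 2)) = η :=
      (strictAntiOn_wright_one hν0 hν).injOn (show 0 ≤ s t / (lam * t ^ (α / 2)) by positivity)
        hη.le h1
    rw [div_eq_iff (by positivity)] at h2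
    rw [h2, s₃]
    ring
  refine ⟨η, hη, ?_, ?_, hs⟩
  · rw [← stefan_iff_K (b := b) hα0 hα1 hlam hh hm hη hbq]
    have h1 := hsol.stefan 1 one_pos
    -- Only the derivative on (0, 1) enters, so it does not matter that `s` and `s₃` may differ at
    -- negative times.
    have h2 : caputoDeriv α s 1 = caputoDeriv α (s₃ α lam η) 1 := by
      refine caputoDeriv_congr zero_le_one fun τ hτ => ?_
      have hd : DifferentiableAt ℝ (s₃ α lam η) τ :=
        ((Real.hasDerivAt_rpow_const (Or.inl hτ.1.ne')).const_mul (lam * η)).differentiableAt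
      refine hd.hasDerivAt.congr_of_eventuallyEq ?_
      filter_upwards [Ioi_mem_nhds hτ.1] with σ hσ using hs σ (le_of_lt hσ)
    rw [h2, (caputo_s₃ hα0 hα1 one_pos).2,
      spaceDeriv_similarity hα0 hα1 hs1 (right_mem_Icc.2 hs1.le), Real.one_rpow, mul_one,
      ← hηdef, div_one, mul_one] at h1
    rw [h1]
    ring
  · intro x t
    have hbeq : b = (D - C) / (1 - wright (-η) (-(α / 2)) 1 + c) := by
      rw [eq_div_iff hq.ne', hbq]
    have ha : a = D - b * c - b := by linarith
    rw [u₃, ← hcdef, mul_div_right_comm, ← hbeq, ha]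
    ring

end FractionalStefan

theorem mainTheorem1 (α lam k h m C D : ℝ) (hα0 : 0 < α) (hα1 : α < 1) (hlam : 0 < lam)
    (hk : 0 < k) (hh : 0 < h) (hm : 0 < m) (hD : 0 < D) (hCD : C < D) :
    ContinuousOn (FractionalStefan.K α lam h m) (Set.Ioi 0) ∧
    StrictMonoOn (FractionalStefan.K α lam h m) (Set.Ioi 0) ∧
    Filter.Tendsto (FractionalStefan.K α lam h m) (𝓝[>] 0) (𝓝 0) ∧
    Filter.Tendsto (FractionalStefan.K α lam h m) Filter.atTop Filter.atTop ∧
    ∃ η : ℝ,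
      (0 < η ∧ FractionalStefan.K α lam h m η =
        k / lam ^ 2 * (Real.Gamma (1 - α / 2) / Real.Gamma (1 + α / 2)) * (D - C)) ∧
      (∀ η' : ℝ, 0 < η' → FractionalStefan.K α lam h m η' =
        k / lam ^ 2 * (Real.Gamma (1 - α / 2) / Real.Gamma (1 + α / 2)) * (D - C) → η' = η) ∧
      FractionalStefan.IsSolution α lam k h m C D
        (FractionalStefan.u₃ α lam h m C D η) (FractionalStefan.s₃ α lam η) ∧
      (∀ (a b : ℝ) (s : ℝ → ℝ),
        FractionalStefan.IsSolution α lam k h m C D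
          (fun x t => a + b * FractionalStefan.wright (-(x / (lam * t ^ (α / 2)))) (-(α / 2)) 1) s →
        (∀ x t : ℝ, 0 ≤ x → 0 < t →
          a + b * FractionalStefan.wright (-(x / (lam * t ^ (α / 2)))) (-(α / 2)) 1 =
            FractionalStefan.u₃ α lam h m C D η x t) ∧
        ∀ t : ℝ, 0 ≤ t → s t = FractionalStefan.s₃ α lam η t) := by
  have hG1 : 0 < Real.Gamma (1 - α / 2) := Real.Gamma_pos_of_pos (by linarith)
  have hG2 : 0 < Real.Gamma (1 + α / 2) := Real.Gamma_pos_of_pos (by linarith)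
  have hDC : 0 < D - C := sub_pos.2 hCD
  have hmono := strictMonoOn_K hα0 hα1 hlam hh hm
  obtain ⟨η, hη, hKη⟩ := exists_K_eq hα0 hα1 hlam hh hm (show 0 < k / lam ^ 2 *
    (Real.Gamma (1 - α / 2) / Real.Gamma (1 + α / 2)) * (D - C) by positivity)
  have huniq : ∀ η' : ℝ, 0 < η' → K α lam h m η' =
      k / lam ^ 2 * (Real.Gamma (1 - α / 2) / Real.Gamma (1 + α / 2)) * (D - C) → η' = η :=
    fun η' hη' h' => hmono.injOn hη' hη (h'.trans hKη.symm)
  refine ⟨(continuousOn_K hα0 hα1).mono Ioi_subset_Ici_self, hmono, tendsto_K_zero hα0 hα1,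
    tendsto_K_atTop hα0 hα1 hlam hh hm, η, ⟨hη, hKη⟩, huniq, ?_, ?_⟩
  · have hc := convection_const_pos hα1 hlam hh hm
    have hE := wright_one_le_one (ν := α / 2) (by linarith) (by linarith) hη.le
    set c := m / (h * lam * Real.Gamma (1 - α / 2)) with hcdef
    set q := 1 - wright (-η) (-(α / 2)) 1 + c with hqdef
    have hq : 0 < q := by linarith
    set b := (D - C) / q with hbdef
    have hbq : b * q = D - C := div_mul_cancel₀ _ hq.ne'
    -- Splitting the bracket in the numerator of `u₃` exhibits it as a + b W with b = (D - C)/q and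
    -- a = D - b c - b.
    have hu : u₃ α lam h m C D η = fun x t => (D - b * c - b) +
        b * wright (-(x / (lam * t ^ (α / 2)))) (-(α / 2)) 1 := by
      funext x t
      rw [u₃, ← hcdef, ← hqdef, mul_div_right_comm, ← hbdef]
      ring
    rw [hu]
    refine isSolution_similarity hα0 hα1 hlam hh hη (by positivity) (by ring) ?_
      ((stefan_iff_K (b := b) hα0 hα1 hlam hh hm hη hbq).2 hKη)
    rw [hqdef] at hbq
    linarith
  · intro a b s hsol
    obtain ⟨η', hη', hK', hu, hs⟩ := similarity_solution_unique hα0 hα1 hlam hh hm hCD hsol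
    obtain rfl := huniq η' hη' hK'
    exact ⟨fun x t _ _ => hu x t, hs⟩
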